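/- Let $P=((V,E),(V_1,V_R),\delta)$ be a Markov decision process (MDP): a finite directed graph $(V,E)$ with $n$ vertices and $m$ edges in which every vertex has at least one outgoing edge, a partition of $V$ into player 1 vertices $V_1$ and random vertices $V_R$, and for each $v\in V_R$ a probability distribution $\delta(v)$ on $V$ with $\delta(v)[w]>0$ if and only if $(v,w)\in E$. A strategy $\sigma$ of player 1 chooses, for each finite history that ends in a player 1 vertex, a successor of that vertex; $\Pr^\sigma_v$ is the resulting probability measure on infinite paths from $v$. For $T\subseteq V$ let $\mathrm{AS}(P,T)$ be the set of all $v\in V$ for which there is a strategy $\sigma$ such that $\Pr^\sigma_v(\text{the play visits } T)=1$. The almost-sure winning set of the disjunctive reachability query with target sets $T_1,\dots,T_k\subseteq V$ $(k\ge 1)$ is $\bigcup_{i=1}^k \mathrm{AS}(P,T_i)$. An end-component of $P$ is a set $X\subseteq V$ whose induced subgraph is strongly connected and has at least one edge, and such that all edges that start in a random vertex of $X$ end in $X$. The MEC-decomposition of $P$ consists of the inclusion-maximal end-components (MECs) of $P$ and the set of the vertices that lie in no MEC. **Theorem.** The almost-sure winning set of the disjunctive reachability query can be computed in time $O(k\cdot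 m+\mathrm{MEC})$, where $\mathrm{MEC}$ is the time to compute the MEC-decomposition. Precisely: there is an absolute constant $C$ such that, for every function $\mathrm{MEC}:\mathbb N^2\to\mathbb N$ and every program that computes the MEC-decomposition of each MDP with $n$ vertices and $m$ edges in time at most $\mathrm{MEC}(n,m)$, there is a program that computes, for every MDP with $n$ vertices and $m$ edges and all target sets $T_1,\dots,T_k$ with $k\ge 1$, the set $\bigcup_{i=1}^k \mathrm{AS}(P,T_i)$ in time at most $C\cdot(k\cdot m+\mathrm{MEC}(n,m))$. Here programs run on a unit-cost random access machine with natural-number registers and finitely many arrays, with assignment, addition, truncated subtraction, indirect loads and stores, comparisons, branching and loops. The graph is given as a list of its edges in arbitrary order with a flag for each random vertex, and the target sets as $k$ lists of vertices; the probabilities are not part of the input. The MEC-decomposition is output as a vertex labelling that is zero exactly outside the MECs and, on vertices in MECs, takes equal values exactly on vertices of the same MEC; a set of vertices is output as its characteristic vector. -/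

import Mathlib

open MeasureTheory ProbabilityTheory

/-! ## Markov decision processes, end-components, almost-sure winning sets -/

/-- A Markov decision process with vertex set `V` (assumed finite where it is used): a directed
graph, a partition of the vertices into random vertices (`random`) and player 1 vertices (the
complement), and a probability distribution for each random vertex whose support is the set of its
successors. Every vertex has a successor, so that plays are infinite. -/
structure MDP (V : Type*) where
  edge : V → V → Prop
  random : Set V
  δ : {v : V // v ∈ random} → PMF V
  edge_iff : ∀ (v : {v : V // v ∈ random}) (w : V), edge v.1 w ↔ 0 < δ v w
  exists_edge : ∀ v : V, ∃ w : V, edge v w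

namespace MDP

section EndComponents

variable {V : Type*}

/-- An end-component: (a) the induced subgraph is strongly connected, (b) no edge leaves it from a
random vertex, (c) the induced subgraph has at least one edge. -/
def IsEC (P : MDP V) (X : Set V) : Prop :=
  (∀ u ∈ X, ∀ v ∈ X, Relation.ReflTransGen (fun a b => a ∈ X ∧ b ∈ X ∧ P.edge a b) u v) ∧
  (∀ v ∈ X, v ∈ P.random → ∀ w, P.edge v w → w ∈ X) ∧
  (∃ u ∈ X, ∃ v ∈ X, P.edge u v)

/-- A maximal end-component (maximal under set inclusion). -/
def IsMEC (P : MDP V) (X : Set V) : Prop :=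
  Maximal P.IsEC X

/-- The play prefix `v₀, …, vₙ` ends in this vertex `vₙ`. -/
def lastVertex {n : ℕ} (h : Finset.Iic n → V) : V :=
  h ⟨n, Finset.mem_Iic.2 le_rfl⟩

/-- A player 1 strategy: to each finite history `v₀, …, vₙ` that ends in a player 1 vertex it
assigns a successor of `vₙ` (the value at other histories is never used). -/
structure Strategy (P : MDP V) where
  act : (n : ℕ) → (Finset.Iic n → V) → V
  edge_act : ∀ (n : ℕ) (h : Finset.Iic n → V),
    lastVertex h ∉ P.random → P.edge (lastVertex h) (act n h)

end EndComponents

section Plays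

variable {V : Type*} [Finite V] [MeasurableSpace V] [DiscreteMeasurableSpace V]

open Classical in
/-- The law of the next vertex after the history `h`, under the strategy `σ`. -/
noncomputable def stepLaw (P : MDP V) (σ : P.Strategy) (n : ℕ) (h : Finset.Iic n → V) :
    Measure V :=
  if hr : lastVertex h ∈ P.random then (P.δ ⟨lastVertex h, hr⟩).toMeasure
  else Measure.dirac (σ.act n h)

/-- `stepLaw` as a probability kernel from histories of length `n + 1` to the next vertex. -/
noncomputable def stepKernel (P : MDP V) (σ : P.Strategy) (n : ℕ) :
    Kernel (Finset.Iic n → V) V :=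
  Kernel.ofFunOfCountable (P.stepLaw σ n)

instance (P : MDP V) (σ : P.Strategy) (n : ℕ) : IsMarkovKernel (P.stepKernel σ n) := by
  refine ⟨fun h => ?_⟩
  change IsProbabilityMeasure (P.stepLaw σ n h)
  unfold stepLaw
  split_ifs
  · exact PMF.toMeasure.isProbabilityMeasure _
  · infer_instance

/-- The probability measure on infinite vertex sequences that is induced by starting in `v` and
playing according to `σ` (Ionescu-Tulcea). -/
noncomputable def playMeasure (P : MDP V) (σ : P.Strategy) (v : V) : Measure (ℕ → V) :=
  Kernel.traj (X := fun _ => V) (P.stepKernel σ) 0 (fun _ => v)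

/-- The plays: infinite paths of the graph. -/
def plays (P : MDP V) : Set (ℕ → V) :=
  {ω | ∀ i, P.edge (ω i) (ω (i + 1))}

/-- The reachability objective of the target set `T`. -/
def reach (P : MDP V) (T : Set V) : Set (ℕ → V) :=
  {ω | ω ∈ P.plays ∧ ∃ j, ω j ∈ T}

/-- The almost-sure winning set of player 1 for the objective `ψ`. -/
def almostSure (P : MDP V) (ψ : Set (ℕ → V)) : Set V :=
  {v | ∃ σ : P.Strategy, P.playMeasure σ v ψ = 1}

/-- The almost-sure winning set for the disjunctive query of the reachability objectives of
`T 0, …, T (k - 1)`: the union of the `k` almost-sure winning sets. -/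
def disjQueryReach (P : MDP V) {k : ℕ} (T : Fin k → Set V) : Set V :=
  {v | ∃ i, v ∈ P.almostSure (P.reach (T i))}

end Plays

end MDP

/-! ## The machine model

A unit-cost random access machine with addition and (truncated) subtraction, programmed in a
structured language. It has registers `0, 1, 2, …` and arrays `0, 1, 2, …`, of which a program
can name only finitely many; each array has cells `0, 1, 2, …`, addressed indirectly
through a register. Registers and cells hold natural numbers. Every executed instruction and every
evaluated test takes one time step. -/

namespace RAM

/-- The memory: `reg x` is the content of register `x`, `arr a i` that of cell `i` of array `a`. -/
structure Store where
  reg : ℕ → ℕ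
  arr : ℕ → ℕ → ℕ

/-- The instructions. -/
inductive Instr
  /-- do nothing -/
  | skip
  /-- register `x` becomes the constant `c` -/
  | const (x c : ℕ)
  /-- register `x` becomes the content of register `y` -/
  | copy (x y : ℕ)
  /-- register `x` becomes the sum of the registers `y` and `z` -/
  | add (x y z : ℕ)
  /-- register `x` becomes the truncated difference of the registers `y` and `z` -/
  | sub (x y z : ℕ)
  /-- register `x` becomes the content of the cell of array `a` that register `i` points to -/
  | load (x a i : ℕ)
  /-- the cell of array `a` that register `i` points to becomes the content of register `x` -/
  | store (a i x : ℕ)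

/-- The effect of an instruction. -/
def Instr.apply : Instr → Store → Store
  | .skip, s => s
  | .const x c, s => { s with reg := Function.update s.reg x c }
  | .copy x y, s => { s with reg := Function.update s.reg x (s.reg y) }
  | .add x y z, s => { s with reg := Function.update s.reg x (s.reg y + s.reg z) }
  | .sub x y z, s => { s with reg := Function.update s.reg x (s.reg y - s.reg z) }
  | .load x a i, s => { s with reg := Function.update s.reg x (s.arr a (s.reg i)) }
  | .store a i x, s =>
      { s with arr := Function.update s.arr a (Function.update (s.arr a) (s.reg i) (s.reg x)) }

/-- The tests: compare the contents of two registers. -/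
inductive Test
  | lt (x y : ℕ)
  | eq (x y : ℕ)

/-- When a test succeeds in a store. -/
def Test.Holds : Test → Store → Prop
  | .lt x y, s => s.reg x < s.reg y
  | .eq x y, s => s.reg x = s.reg y

/-- Programs. -/
inductive Prog
  | instr (c : Instr)
  | seq (p q : Prog)
  | ite (b : Test) (p q : Prog)
  | loop (b : Test) (p : Prog)

/-- `Exec p s s' t`: started in the store `s`, the program `p` halts after exactly `t` time steps,
in the store `s'`. -/
inductive Exec : Prog → Store → Store → ℕ → Prop
  | instr (c : Instr) (s : Store) : Exec (.instr c) s (c.apply s) 1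
  | seq {p q : Prog} {s₁ s₂ s₃ : Store} {t₁ t₂ : ℕ} :
      Exec p s₁ s₂ t₁ → Exec q s₂ s₃ t₂ → Exec (.seq p q) s₁ s₃ (t₁ + t₂)
  | ite_true {b : Test} {p q : Prog} {s s' : Store} {t : ℕ} :
      b.Holds s → Exec p s s' t → Exec (.ite b p q) s s' (t + 1)
  | ite_false {b : Test} {p q : Prog} {s s' : Store} {t : ℕ} :
      ¬ b.Holds s → Exec q s s' t → Exec (.ite b p q) s s' (t + 1)
  | loop_false {b : Test} {p : Prog} {s : Store} :
      ¬ b.Holds s → Exec (.loop b p) s s 1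
  | loop_true {b : Test} {p : Prog} {s₁ s₂ s₃ : Store} {t₁ t₂ : ℕ} :
      b.Holds s₁ → Exec p s₁ s₂ t₁ → Exec (.loop b p) s₂ s₃ t₂ →
      Exec (.loop b p) s₁ s₃ (t₁ + t₂ + 1)

/-- An array that holds the list `l` in its first cells and `0` in all others. -/
def ofList (l : List ℕ) : ℕ → ℕ :=
  fun i => l.getD i 0

end RAM

/-! ## The two computational problems -/

open RAM

/-- `E` lists the edges of `P`, each exactly once, in an arbitrary order. -/
def IsEdgeList {n : ℕ} (P : MDP (Fin n)) (E : List (Fin n × Fin n)) : Prop :=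
  E.Nodup ∧ ∀ u v, (u, v) ∈ E ↔ P.edge u v

/-- The lists `L` enumerate the elements of the target sets `T`, each exactly once, in
arbitrary order. -/
def AreTargetLists {n k : ℕ} (T : Fin k → Set (Fin n)) (L : Fin k → List (Fin n)) : Prop :=
  ∀ i, (L i).Nodup ∧ ∀ v, v ∈ L i ↔ v ∈ T i

open Classical in
/-- The input of an algorithm on MDPs. Register `0` holds the number `n` of vertices, register `1`
the number `m` of edges; for `v < n`, cell `v` of array `0` holds `1` if `v` is random and `0` if it
belongs to player 1; for `e < m`, cell `e` of array `1` and of array `2` holds the source and the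
target of the `e`-th edge. Everything else is `0`. -/
noncomputable def mdpInput {n : ℕ} (P : MDP (Fin n)) (E : List (Fin n × Fin n)) : Store where
  reg := ofList [n, E.length]
  arr
    | 0 => ofList ((List.finRange n).map fun v => if v ∈ P.random then 1 else 0)
    | 1 => ofList (E.map fun e => (e.1 : ℕ))
    | 2 => ofList (E.map fun e => (e.2 : ℕ))
    | _ => fun _ => 0

open Classical in
/-- The input of an algorithm on MDPs with `k` target sets: as `mdpInput`; moreover register `2`
holds `k`, array `4` holds the concatenation of the `k` lists of targets, and for `i ≤ k`, cell `i`
of array `3` holds the total length of the first `i` lists (so that list `i` occupies the cells of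
array `4` from there up to, but excluding, the one given by cell `i + 1` of array `3`). -/
noncomputable def queryInput {n k : ℕ} (P : MDP (Fin n)) (E : List (Fin n × Fin n))
    (L : Fin k → List (Fin n)) : Store where
  reg := ofList [n, E.length, k]
  arr
    | 0 => ofList ((List.finRange n).map fun v => if v ∈ P.random then 1 else 0)
    | 1 => ofList (E.map fun e => (e.1 : ℕ))
    | 2 => ofList (E.map fun e => (e.2 : ℕ))
    | 3 => ofList ((List.range (k + 1)).map fun i => (((List.ofFn L).take i).map List.length).sum)
    | 4 => ofList ((List.ofFn L).flatten.map fun v => (v : ℕ))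
    | _ => fun _ => 0

/-- Output of a MEC-decomposition, in array `5`: a vertex gets a nonzero label iff it lies in some
MEC, and two vertices with nonzero labels get the same label iff they lie in the same MEC. -/
def IsMECOutput {n : ℕ} (P : MDP (Fin n)) (s : Store) : Prop :=
  (∀ v : Fin n, s.arr 5 v ≠ 0 ↔ ∃ X, P.IsMEC X ∧ v ∈ X) ∧
  (∀ u v : Fin n, s.arr 5 u ≠ 0 → s.arr 5 v ≠ 0 →
    (s.arr 5 u = s.arr 5 v ↔ ∃ X, P.IsMEC X ∧ u ∈ X ∧ v ∈ X))

/-- Output of a set of vertices, in array `5`: its characteristic vector. -/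
def IsSetOutput {n : ℕ} (W : Set (Fin n)) (s : Store) : Prop :=
  ∀ v : Fin n, (v ∈ W → s.arr 5 v = 1) ∧ (v ∉ W → s.arr 5 v = 0)

/-- The program `M` computes the MEC-decomposition of every MDP with `n` vertices and `m` edges in
time at most `τ n m`. -/
def ComputesMEC (M : Prog) (τ : ℕ → ℕ → ℕ) : Prop :=
  ∀ (n : ℕ) (P : MDP (Fin n)) (E : List (Fin n × Fin n)), IsEdgeList P E →
    ∃ (s : Store) (t : ℕ), Exec M (mdpInput P E) s t ∧ t ≤ τ n E.length ∧ IsMECOutput P s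

/-- The program `A` computes the almost-sure winning set for the disjunctive reachability query of
every MDP with `n` vertices and `m` edges and every `k ≥ 1` target sets, in time at most
`τ n m k`. -/
def ComputesDisjReach (A : Prog) (τ : ℕ → ℕ → ℕ → ℕ) : Prop :=
  ∀ (n k : ℕ) (P : MDP (Fin n)) (E : List (Fin n × Fin n)) (T : Fin k → Set (Fin n))
    (L : Fin k → List (Fin n)), 1 ≤ k → IsEdgeList P E → AreTargetLists T L →
    ∃ (s : Store) (t : ℕ), Exec A (queryInput P E L) s t ∧ t ≤ τ n E.length k ∧
      IsSetOutput (P.disjQueryReach T) s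

namespace MDP

/-! Contract each maximal end-component (MEC) to a single class; every other vertex is a class of
its own. No edge leaves a MEC from a random vertex, so all its exits belong to player 1, who can
steer to any of them almost surely: a MEC behaves like one player 1 vertex. For a single target set
`T`, the losing classes form a least fixed point. A class that contains a target never loses. A
random vertex outside the MECs loses as soon as one edge leads to a losing class. Any other class
loses as soon as all edges that leave it do, in particular if there are none. Each rule compares the
number of edges into the losing set with a threshold, namely `m + 1`, `1` or the number of all
leaving edges (`loseThreshold`).

That the complement `W` of the fixed point wins rests on `exists_progress`: wherever the part of `W`
already known to reach `T` stops growing, a bottom strongly connected component of the remainder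
would be a MEC without an exit into `W`. Progress yields a potential `g > 0` on `W` that a
positional choice doubles in expectation off `T`. Then `2 - g` contracts geometrically, and
`mem_almostSure_reach` bounds the probability of avoiding `T` by `c ^ n` times a constant, with `c <
1`.

That the fixed point loses is shown by a function which vanishes on `T`, is positive on the losing
classes, and cannot be decreased in expectation by any choice. It is a submartingale, so the
probability of avoiding `T` stays bounded away from zero (`notMem_almostSure_reach`). Leastness lets
this function be built by adding one class at a time. Both halves meet in
`mem_almostSure_iff_threshold`.

The given decomposition program runs once, on a relocated copy of the input (`Exec.shift`), and the
contracted edge lists and exit counts are computed once. Each query then counts down the thresholds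
with a worklist that handles every edge at most once (`Worklist`, `runs_propagate`), in time `O(n +
m)`. Every vertex has a successor, so `n ≤ m`, and the total is `O(k * m + MEC)`. -/

theorem measurableSet_avoid {V : Type*} [MeasurableSpace V] [DiscreteMeasurableSpace V]
    (T : Set V) (n : ℕ) :
    MeasurableSet {ω : ℕ → V | ∀ j ≤ n, ω j ∉ T} := by
  have : {ω : ℕ → V | ∀ j ≤ n, ω j ∉ T} = ⋂ j, ⋂ (_ : j ≤ n), (fun ω => ω j) ⁻¹' Tᶜ := by
    ext ω; simp
  rw [this]
  exact MeasurableSet.iInter fun j => MeasurableSet.iInter fun _ =>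
    (measurable_pi_apply j) (MeasurableSet.of_discrete)

/-! ### Expectations along plays and two potential-function criteria for almost-sure reachability -/

section Plays

variable {V : Type*} [Finite V] [MeasurableSpace V] [DiscreteMeasurableSpace V]

instance (P : MDP V) (σ : P.Strategy) (v : V) : IsProbabilityMeasure (P.playMeasure σ v) := by
  unfold playMeasure
  infer_instance

/-- Integrating a function of a history and its next vertex: the next vertex is drawn from
`stepLaw`. -/
theorem lintegral_playMeasure_succ (P : MDP V) (σ : P.Strategy) (v : V) (n : ℕ)
    (F : (Finset.Iic n → V) → V → ENNReal) :
    ∫⁻ ω, F (Preorder.frestrictLe n ω) (ω (n + 1)) ∂P.playMeasure σ v =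
      ∫⁻ ω, ∫⁻ w, F (Preorder.frestrictLe n ω) w ∂P.stepLaw σ n (Preorder.frestrictLe n ω)
        ∂P.playMeasure σ v := by
  have hF : Measurable (Function.uncurry F) := measurable_of_countable _
  have h1 := Kernel.partialTraj_compProd_eq_map_traj (X := fun _ => V) (κ := P.stepKernel σ)
    (Nat.zero_le n) (x₀ := fun _ => v)
  have hm : Measurable (fun ω : ℕ → V => (Preorder.frestrictLe n ω, ω (n + 1))) := by fun_prop
  have h2 : ∫⁻ ω, F (Preorder.frestrictLe n ω) (ω (n + 1)) ∂P.playMeasure σ v =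
      ∫⁻ p, Function.uncurry F p
        ∂((Kernel.traj (X := fun _ => V) (P.stepKernel σ) 0 (fun _ => v)).map
          (fun x ↦ (Preorder.frestrictLe n x, x (n + 1)))) := by
    rw [lintegral_map hF hm]
    rfl
  rw [h2, ← h1, Measure.lintegral_compProd hF,
    ← Kernel.traj_map_frestrictLe_apply, lintegral_map (measurable_of_countable _) (by fun_prop)]
  rfl

theorem ae_zero_eq (P : MDP V) (σ : P.Strategy) (v : V) :
    ∀ᵐ ω ∂P.playMeasure σ v, ω 0 = v := by
  have h1 := Kernel.traj_map_frestrictLe_apply (X := fun _ => V) (κ := P.stepKernel σ) 0 0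
    (fun _ => v)
  rw [Kernel.partialTraj_self, Kernel.id_apply] at h1
  have h2 : ∀ᵐ x ∂((P.playMeasure σ v).map (Preorder.frestrictLe (π := fun _ => V) 0)),
      x = fun _ => v := by
    unfold playMeasure
    rw [h1]
    exact (ae_dirac_iff (Set.toFinite _).measurableSet).2 rfl
  have h3 := ae_of_ae_map (by fun_prop) h2
  filter_upwards [h3] with ω hω
  exact congrFun hω ⟨0, by simp⟩

theorem lintegral_stepLaw_random (P : MDP V) (σ : P.Strategy) (n : ℕ) (h : Finset.Iic n → V)
    (hr : lastVertex h ∈ P.random) (k : V → ENNReal) :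
    ∫⁻ w, k w ∂P.stepLaw σ n h = ∑' w, P.δ ⟨lastVertex h, hr⟩ w * k w := by
  have := Fintype.ofFinite V
  simp only [stepLaw, dif_pos hr]
  rw [lintegral_countable']
  refine tsum_congr fun w => ?_
  rw [PMF.toMeasure_apply_singleton _ _ (by measurability), mul_comm]

theorem lintegral_stepLaw_player (P : MDP V) (σ : P.Strategy) (n : ℕ) (h : Finset.Iic n → V)
    (hr : lastVertex h ∉ P.random) (k : V → ENNReal) :
    ∫⁻ w, k w ∂P.stepLaw σ n h = k (σ.act n h) := by
  simp only [stepLaw, dif_neg hr]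
  rw [lintegral_dirac]

/-- At each time the indicator of a non-edge has expectation zero under the step law; countably many
times are combined. -/
theorem ae_plays (P : MDP V) (σ : P.Strategy) (v : V) :
    ∀ᵐ ω ∂P.playMeasure σ v, ω ∈ P.plays := by
  classical
  unfold plays
  simp only [Set.mem_ofPred_eq]
  rw [ae_all_iff]
  intro n
  have h1 := P.lintegral_playMeasure_succ σ v n
    (fun h w => if P.edge (lastVertex h) w then 0 else 1)
  have h2 : ∀ h : Finset.Iic n → V, ∫⁻ w, (if P.edge (lastVertex h) w then 0 else 1)
      ∂P.stepLaw σ n h = 0 := by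
    intro h
    by_cases hr : lastVertex h ∈ P.random
    · rw [lintegral_stepLaw_random _ _ _ _ hr]
      refine ENNReal.tsum_eq_zero.2 fun w => ?_
      split_ifs with he
      · simp
      · rw [P.edge_iff ⟨_, hr⟩] at he
        simpa using he
    · rw [lintegral_stepLaw_player _ _ _ _ hr, if_pos (σ.edge_act n h hr)]
  simp only [h2, lintegral_zero] at h1
  rw [lintegral_eq_zero_iff' (by
    refine Measurable.aemeasurable ?_
    have hm : Measurable (fun ω : ℕ → V => (Preorder.frestrictLe n ω, ω (n + 1))) := by fun_prop
    exact (measurable_of_countable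
      (fun p : (Finset.Iic n → V) × V => if P.edge (lastVertex p.1) p.2 then (0 : ENNReal) else 1)).comp
      hm)] at h1
  filter_upwards [h1] with ω hω
  by_contra hne
  have : P.edge (lastVertex (Preorder.frestrictLe (π := fun _ => V) n ω)) (ω (n + 1)) := by
    by_contra h3
    simp [h3] at hω
  exact hne this

/-- The expected value of `k` at time `n`, on the plays that avoid `T` up to time `n`. -/
noncomputable def avoidValue (P : MDP V) (σ : P.Strategy) (v : V) (T : Set V) (k : V → ENNReal)
    (n : ℕ) : ENNReal :=
  ∫⁻ ω, {ω : ℕ → V | ∀ j ≤ n, ω j ∉ T}.indicator (fun ω => k (ω n)) ω ∂P.playMeasure σ v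

theorem avoidValue_zero (P : MDP V) (σ : P.Strategy) {v : V} {T : Set V} (hv : v ∉ T)
    (k : V → ENNReal) : P.avoidValue σ v T k 0 = k v := by
  unfold avoidValue
  have : ∀ᵐ ω ∂P.playMeasure σ v,
      {ω : ℕ → V | ∀ j ≤ 0, ω j ∉ T}.indicator (fun ω => k (ω 0)) ω = k v := by
    filter_upwards [P.ae_zero_eq σ v] with ω hω
    rw [Set.indicator_of_mem]
    · simp [hω]
    · simp [hω, hv]
  rw [lintegral_congr_ae this]
  simp

/-- Replace the last vertex of a history by a draw from `stepLaw`. -/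
theorem lintegral_avoid_succ (P : MDP V) (σ : P.Strategy) (v : V) (T : Set V)
    (k : V → ENNReal) (n : ℕ) :
    ∫⁻ ω, {ω : ℕ → V | ∀ j ≤ n, ω j ∉ T}.indicator (fun ω => k (ω (n + 1))) ω
        ∂P.playMeasure σ v =
      ∫⁻ ω, {ω : ℕ → V | ∀ j ≤ n, ω j ∉ T}.indicator
        (fun ω => ∫⁻ w, k w ∂P.stepLaw σ n (Preorder.frestrictLe n ω)) ω ∂P.playMeasure σ v := by
  classical
  have h1 := P.lintegral_playMeasure_succ σ v n
    (fun h w => if ∀ j, h j ∉ T then k w else 0)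
  have h3 : ∀ ω : ℕ → V, (∀ j : Finset.Iic n, Preorder.frestrictLe (π := fun _ => V) n ω j ∉ T) ↔
      ∀ j ≤ n, ω j ∉ T := by
    intro ω
    simp [Preorder.frestrictLe]
  simp only [h3] at h1
  simp only [Set.indicator_apply, Set.mem_ofPred_eq]
  rw [h1]
  refine lintegral_congr fun ω => ?_
  split_ifs <;> simp

/-- Conditioning on the history turns a one-step bound off `T` into a bound on expectations.
Dropping the plays that enter `T` at time `n + 1` only decreases the value. -/
theorem avoidValue_succ_le (P : MDP V) (σ : P.Strategy) (v : V) (T : Set V) (k : V → ENNReal)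
    (c : ENNReal)
    (hk : ∀ n (h : Finset.Iic n → V), lastVertex h ∉ T →
      ∫⁻ w, k w ∂P.stepLaw σ n h ≤ c * k (lastVertex h)) (n : ℕ) :
    P.avoidValue σ v T k (n + 1) ≤ c * P.avoidValue σ v T k n := by
  unfold avoidValue
  rw [← lintegral_const_mul _ ((Measurable.indicator (by
    exact (measurable_of_countable k).comp (measurable_pi_apply n)) (measurableSet_avoid T n)))]
  calc _ ≤ ∫⁻ ω, {ω : ℕ → V | ∀ j ≤ n, ω j ∉ T}.indicator (fun ω => k (ω (n + 1))) ω
        ∂P.playMeasure σ v := by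
        refine lintegral_mono fun ω => ?_
        have hsub : {ω : ℕ → V | ∀ j ≤ n + 1, ω j ∉ T} ⊆ {ω : ℕ → V | ∀ j ≤ n, ω j ∉ T} :=
          fun ω hω j hj => hω j (by omega)
        exact Set.indicator_le_indicator_of_subset hsub (fun _ => bot_le) ω
    _ = _ := P.lintegral_avoid_succ σ v T k n
    _ ≤ _ := by
        refine lintegral_mono fun ω => ?_
        by_cases hω : ω ∈ {ω : ℕ → V | ∀ j ≤ n, ω j ∉ T}
        · simp only [Set.indicator_of_mem hω]
          exact hk n _ (hω n le_rfl)
        · simp [Set.indicator_of_notMem hω]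

/-- The plays that enter `T` at time `n + 1` are lost from the integral, but they carry the value
`0`, so the submartingale inequality survives stopping. -/
theorem le_avoidValue_succ (P : MDP V) (σ : P.Strategy) (v : V) (T : Set V) (k : V → ENNReal)
    (hT : ∀ t ∈ T, k t = 0)
    (hk : ∀ n (h : Finset.Iic n → V), lastVertex h ∉ T →
      k (lastVertex h) ≤ ∫⁻ w, k w ∂P.stepLaw σ n h) (n : ℕ) :
    P.avoidValue σ v T k n ≤ P.avoidValue σ v T k (n + 1) := by
  unfold avoidValue
  calc _ ≤ ∫⁻ ω, {ω : ℕ → V | ∀ j ≤ n, ω j ∉ T}.indicator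
        (fun ω => ∫⁻ w, k w ∂P.stepLaw σ n (Preorder.frestrictLe n ω)) ω ∂P.playMeasure σ v := by
        refine lintegral_mono fun ω => ?_
        by_cases hω : ω ∈ {ω : ℕ → V | ∀ j ≤ n, ω j ∉ T}
        · simp only [Set.indicator_of_mem hω]
          exact hk n _ (hω n le_rfl)
        · simp [Set.indicator_of_notMem hω]
    _ = _ := (P.lintegral_avoid_succ σ v T k n).symm
    _ ≤ _ := by
        refine lintegral_mono fun ω => ?_
        by_cases hω : ω ∈ {ω : ℕ → V | ∀ j ≤ n, ω j ∉ T}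
        · simp only [Set.indicator_of_mem hω]
          by_cases ht : ω (n + 1) ∈ T
          · simp [hT _ ht]
          · rw [Set.indicator_of_mem]
            intro j hj
            rcases Nat.lt_or_ge n j with h | h
            · obtain rfl : j = n + 1 := by omega
              exact ht
            · exact hω j h
        · simp [Set.indicator_of_notMem hω]

/-- A vertex with a positive value under a bounded function that vanishes on `T` and that no
player 1 choice can decrease in expectation is not almost surely winning. -/
theorem notMem_almostSure_reach (P : MDP V) {T : Set V} (k : V → ENNReal) (hle : ∀ v, k v ≠ ⊤)
    (hT : ∀ t ∈ T, k t = 0)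
    (hr : ∀ u (hu : u ∈ P.random), k u ≤ ∑' w, P.δ ⟨u, hu⟩ w * k w)
    (hp : ∀ u, u ∉ P.random → ∀ w, P.edge u w → k u ≤ k w)
    {v : V} (hv : k v ≠ 0) : v ∉ P.almostSure (P.reach T) := by
  rintro ⟨σ, hσ⟩
  have hvT : v ∉ T := fun h => hv (hT v h)
  obtain ⟨B, hB, hkB⟩ : ∃ B : ENNReal, B ≠ ⊤ ∧ ∀ u, k u ≤ B := by
    have := Fintype.ofFinite V
    refine ⟨∑ u, k u, by simp [hle], fun u => ?_⟩
    exact Finset.single_le_sum (f := k) (fun _ _ => zero_le) (Finset.mem_univ u)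
  have hmono : ∀ n, k v ≤ P.avoidValue σ v T k n := by
    intro n
    induction n with
    | zero => exact (P.avoidValue_zero σ hvT k).ge
    | succ n ih =>
      refine ih.trans (P.le_avoidValue_succ σ v T k hT (fun m h _ => ?_) n)
      by_cases hh : lastVertex h ∈ P.random
      · rw [lintegral_stepLaw_random _ _ _ _ hh]
        exact hr _ hh
      · rw [lintegral_stepLaw_player _ _ _ _ hh]
        exact hp _ hh _ (σ.edge_act m h hh)
  -- The expectation is at least `k v` and the integrand at most `B`, so avoiding `T` up to time `n`
  -- has probability at least `k v / B`, uniformly in `n`.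
  have hprob : ∀ n, k v ≤ B * P.playMeasure σ v {ω | ∀ j ≤ n, ω j ∉ T} := by
    intro n
    refine (hmono n).trans ?_
    unfold avoidValue
    rw [← lintegral_indicator_const (measurableSet_avoid T n)]
    exact lintegral_mono fun ω => Set.indicator_le_indicator (hkB _)
  have hlim : Filter.Tendsto (fun n => P.playMeasure σ v {ω : ℕ → V | ∀ j ≤ n, ω j ∉ T})
      Filter.atTop (nhds (P.playMeasure σ v (⋂ n, {ω : ℕ → V | ∀ j ≤ n, ω j ∉ T}))) := by
    refine tendsto_measure_iInter_atTop (fun n => (measurableSet_avoid T n).nullMeasurableSet)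
      (fun a b hab ω hω j hj => hω j (hj.trans hab)) ⟨0, measure_ne_top _ _⟩
  have hnull : P.playMeasure σ v (⋂ n, {ω : ℕ → V | ∀ j ≤ n, ω j ∉ T}) = 0 := by
    have hc : (⋂ n, {ω : ℕ → V | ∀ j ≤ n, ω j ∉ T}) ⊆ {ω | ∃ j, ω j ∈ T}ᶜ := by
      intro ω hω
      simp only [Set.mem_iInter, Set.mem_ofPred_eq] at hω
      simp only [Set.mem_compl_iff, Set.mem_ofPred_eq, not_exists]
      exact fun j => hω j j le_rfl
    have hm : MeasurableSet {ω : ℕ → V | ∃ j, ω j ∈ T} := by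
      have : {ω : ℕ → V | ∃ j, ω j ∈ T} = ⋃ j, (fun ω => ω j) ⁻¹' T := by
        ext ω; simp
      rw [this]
      exact MeasurableSet.iUnion fun j => (measurable_pi_apply j) MeasurableSet.of_discrete
    refine measure_mono_null hc ((prob_compl_eq_zero_iff hm).2 ?_)
    refine le_antisymm prob_le_one (hσ ▸ measure_mono fun ω hω => hω.2)
  rw [hnull] at hlim
  have h0 : k v ≤ B * 0 :=
    ge_of_tendsto' (ENNReal.Tendsto.const_mul hlim (Or.inr hB)) hprob
  simp only [mul_zero, nonpos_iff_eq_zero] at h0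
  exact hv h0

/-- If, from `v`, a positional choice `f` makes a function that is at least `1` off `T` decrease
geometrically in expectation until `T` is reached, then `v` is almost surely winning. -/
theorem mem_almostSure_reach (P : MDP V) {T : Set V} (k : V → ENNReal) (c : ENNReal) (hc : c < 1)
    (h1 : ∀ u ∉ T, 1 ≤ k u) (f : V → V) (hf : ∀ u ∉ P.random, P.edge u (f u))
    (hr : ∀ u (hu : u ∈ P.random), u ∉ T → ∑' w, P.δ ⟨u, hu⟩ w * k w ≤ c * k u)
    (hp : ∀ u, u ∉ P.random → u ∉ T → k (f u) ≤ c * k u)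
    {v : V} (hv : k v ≠ ⊤) : v ∈ P.almostSure (P.reach T) := by
  let σ : P.Strategy := ⟨fun n h => f (lastVertex h), fun n h hh => hf _ hh⟩
  refine ⟨σ, ?_⟩
  suffices h : ∀ᵐ ω ∂P.playMeasure σ v, ∃ j, ω j ∈ T by
    have : ∀ᵐ ω ∂P.playMeasure σ v, ω ∈ P.reach T := by
      filter_upwards [h, P.ae_plays σ v] with ω h1 h2
      exact ⟨h2, h1⟩
    have h3 : P.reach T =ᵐ[P.playMeasure σ v] Set.univ := by
      filter_upwards [this] with ω hω
      exact eq_true hω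
    rw [measure_congr h3, measure_univ]
  by_cases hvT : v ∈ T
  · filter_upwards [P.ae_zero_eq σ v] with ω hω
    exact ⟨0, hω ▸ hvT⟩
  have hdecay : ∀ n, P.avoidValue σ v T k n ≤ c ^ n * k v := by
    intro n
    induction n with
    | zero => simp [P.avoidValue_zero σ hvT k]
    | succ n ih =>
      refine (P.avoidValue_succ_le σ v T k c (fun m h hh => ?_) n).trans ?_
      · by_cases hh' : lastVertex h ∈ P.random
        · rw [lintegral_stepLaw_random _ _ _ _ hh']
          exact hr _ hh' hh
        · rw [lintegral_stepLaw_player _ _ _ _ hh']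
          exact hp _ hh' hh
      · rw [pow_succ', mul_assoc]
        gcongr
  have hprob : ∀ n, P.playMeasure σ v {ω | ∃ j, ω j ∈ T}ᶜ ≤ c ^ n * k v := by
    intro n
    refine le_trans ?_ (hdecay n)
    refine (measure_mono (t := {ω | ∀ j ≤ n, ω j ∉ T}) ?_).trans ?_
    · intro ω hω j _ hj
      exact hω ⟨j, hj⟩
    · unfold avoidValue
      rw [← lintegral_indicator_one (measurableSet_avoid T n)]
      refine lintegral_mono fun ω => ?_
      by_cases hω : ω ∈ {ω : ℕ → V | ∀ j ≤ n, ω j ∉ T}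
      · simp only [Set.indicator_of_mem hω]
        exact h1 _ (hω n le_rfl)
      · simp [Set.indicator_of_notMem hω]
  have hlim : Filter.Tendsto (fun n => c ^ n * k v) Filter.atTop (nhds (0 * k v)) :=
    ENNReal.Tendsto.mul_const (ENNReal.tendsto_pow_atTop_nhds_zero_of_lt_one hc) (Or.inr hv)
  have h0 := ge_of_tendsto' hlim hprob
  simp only [zero_mul, nonpos_iff_eq_zero] at h0
  exact h0

end Plays

end MDP

/-- A positive lower bound for the nonzero values of a function on a finite type. -/
theorem ENNReal.exists_pos_le_of_ne_zero {ι : Type*} [Finite ι] (f : ι → ENNReal) :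
    ∃ d : ENNReal, d ≠ 0 ∧ d ≤ 1 ∧ ∀ i, f i ≠ 0 → d ≤ f i := by
  classical
  have := Fintype.ofFinite ι
  refine ⟨Finset.univ.inf (fun i => if f i = 0 then 1 else f i) ⊓ 1, ?_, inf_le_right, ?_⟩
  · rw [← pos_iff_ne_zero, lt_inf_iff]
    refine ⟨(Finset.lt_inf_iff (by simp)).2 fun i _ => ?_, by simp⟩
    split_ifs with h
    · simp
    · exact pos_iff_ne_zero.2 h
  · intro i hi
    refine inf_le_left.trans ((Finset.inf_le (Finset.mem_univ i)).trans ?_)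
    simp [hi]

/-! ### Winning regions and losing certificates -/

namespace MDP

section Graph

variable {V : Type*}

/-- Every vertex of an end-component has a successor in it. -/
theorem IsEC.exists_edge {P : MDP V} {X : Set V} (hX : P.IsEC X) {v : V} (hv : v ∈ X) :
    ∃ w ∈ X, P.edge v w := by
  obtain ⟨a, ha, b, hb, hab⟩ := hX.2.2
  rcases Relation.ReflTransGen.cases_head (hX.1 v hv a ha) with h | ⟨c, hc, _⟩
  · exact ⟨b, hb, h ▸ hab⟩
  · exact ⟨c, hc.2.1, hc.2.2⟩

/-- A nonempty set `D` in which every vertex has a successor contains a strongly connected set that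
is closed under successors in `D`. -/
theorem exists_bottom [Finite V] (P : MDP V) {D : Set V} (hne : D.Nonempty) :
    ∃ B ⊆ D, B.Nonempty ∧ (∀ u ∈ B, ∀ w ∈ D, P.edge u w → w ∈ B) ∧
      ∀ u ∈ B, ∀ v ∈ B, Relation.ReflTransGen (fun a b => a ∈ B ∧ b ∈ B ∧ P.edge a b) u v := by
  let r : V → V → Prop := fun a b => b ∈ D ∧ P.edge a b
  let R : V → Set V := fun v => {u | Relation.ReflTransGen r v u}
  -- A vertex whose reachable set is inclusion-minimal: everything reachable from it can reach all
  -- of that set, which is therefore a bottom component.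
  obtain ⟨v, hv, hmin⟩ := (Set.toFinite D).exists_minimalFor (fun v => R v) D hne
  have hRD : ∀ u ∈ R v, u ∈ D := by
    intro u hu
    rcases Relation.ReflTransGen.cases_tail hu with h | ⟨_, _, h⟩
    · exact h ▸ hv
    · exact h.1
  have hsub : ∀ u ∈ R v, R u ⊆ R v := fun u hu w hw => Relation.ReflTransGen.trans hu hw
  refine ⟨R v, hRD, ⟨v, .refl⟩, fun u hu w hw he => Relation.ReflTransGen.tail hu ⟨hw, he⟩, ?_⟩
  intro a ha b hb
  have hba : b ∈ R a := hmin (hRD a ha) (hsub a ha) hb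
  change Relation.ReflTransGen r a b at hba
  clear hb
  induction hba with
  | refl => exact .refl
  | tail h1 h2 ih =>
    have h3 : _ ∈ R v := hsub a ha h1
    exact ih.tail ⟨h3, Relation.ReflTransGen.tail h3 h2, h2.2⟩

theorem IsEC.exists_isMEC [Finite V] {P : MDP V} {X : Set V} (hX : P.IsEC X) :
    ∃ Y, P.IsMEC Y ∧ X ⊆ Y := by
  obtain ⟨Y, h1, h2⟩ := Set.Finite.exists_le_maximal (Set.toFinite {X | P.IsEC X}) hX
  exact ⟨Y, h2, h1⟩

/-- The local conditions on a set `W` of vertices that guarantee that player 1 can reach `T` almost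
surely from `W`: they concern the graph in which the maximal end-components are contracted. -/
structure IsWinningRegion (P : MDP V) (T W : Set V) : Prop where
  saturated : ∀ X, P.IsMEC X → ∀ u ∈ X, u ∈ W → X ⊆ W
  random : ∀ v ∈ W, v ∉ T → v ∈ P.random → (∀ X, P.IsMEC X → v ∉ X) → ∀ w, P.edge v w → w ∈ W
  player : ∀ v ∈ W, v ∉ T → v ∉ P.random → (∀ X, P.IsMEC X → v ∉ X) → ∃ w ∈ W, P.edge v w
  exit : ∀ X, P.IsMEC X → X ⊆ W → Disjoint X T → ∃ u ∈ X, ∃ w ∈ W, w ∉ X ∧ P.edge u w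

namespace IsWinningRegion

variable {P : MDP V} {T W : Set V}

theorem random' (h : P.IsWinningRegion T W) {v : V} (hv : v ∈ W) (hT : v ∉ T)
    (hr : v ∈ P.random) {w : V} (he : P.edge v w) : w ∈ W := by
  by_cases hX : ∃ X, P.IsMEC X ∧ v ∈ X
  · obtain ⟨X, hX, hvX⟩ := hX
    exact h.saturated X hX v hvX hv (hX.prop.2.1 v hvX hr w he)
  · push Not at hX
    exact h.random v hv hT hr hX w he

theorem exists_edge (h : P.IsWinningRegion T W) {v : V} (hv : v ∈ W) (hT : v ∉ T) :
    ∃ w ∈ W, P.edge v w := by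
  by_cases hr : v ∈ P.random
  · obtain ⟨w, hw⟩ := P.exists_edge v
    exact ⟨w, h.random' hv hT hr hw, hw⟩
  by_cases hX : ∃ X, P.IsMEC X ∧ v ∈ X
  · obtain ⟨X, hX, hvX⟩ := hX
    obtain ⟨w, hw, he⟩ := hX.prop.exists_edge hvX
    exact ⟨w, h.saturated X hX v hvX hv hw, he⟩
  · push Not at hX
    exact h.player v hv hT hr hX

/-- From a winning region, progress towards `T` is always possible. -/
theorem exists_progress [Finite V] (h : P.IsWinningRegion T W) {G : Set V} (hGW : G ⊆ W)
    (hTG : T ∩ W ⊆ G) (hne : G ≠ W) :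
    ∃ v ∈ W, v ∉ G ∧ v ∉ T ∧ ∃ w ∈ G, P.edge v w := by
  by_contra hcon
  push Not at hcon
  have hDT : ∀ v ∈ W \ G, v ∉ T := fun v hv ht => hv.2 (hTG ⟨ht, hv.1⟩)
  -- Without progress, successors in `W` of vertices in `W \ G` stay there, so a bottom component
  -- `B` of `W \ G` is closed under successors in `W`.
  have hD : ∀ v ∈ W \ G, ∀ w ∈ W, P.edge v w → w ∈ W \ G := fun v hv w hw he =>
    ⟨hw, fun hwG => hcon v hv.1 hv.2 (hDT v hv) w hwG he⟩
  have hDne : (W \ G).Nonempty := by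
    rw [Set.sdiff_nonempty]
    exact fun hWG => hne (Set.Subset.antisymm hGW hWG)
  obtain ⟨B, hBD, ⟨b, hb⟩, hcl, hsc⟩ := P.exists_bottom hDne
  have hcl' : ∀ u ∈ B, ∀ w ∈ W, P.edge u w → w ∈ B := fun u hu w hw he =>
    hcl u hu w (hD u (hBD hu) w hw he) he
  -- Random vertices of `W` off `T` have all successors in `W`, so closure within `W` makes `B` an
  -- end-component.
  have hEC : P.IsEC B := by
    refine ⟨hsc, fun v hv hr w he => ?_, ?_⟩
    · exact hcl' v hv w (h.random' (hBD hv).1 (hDT v (hBD hv)) hr he) he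
    · obtain ⟨w, hw, he⟩ := h.exists_edge (hBD hb).1 (hDT b (hBD hb))
      exact ⟨b, hb, w, hcl' b hb w hw he, he⟩
  obtain ⟨Y, hY, hBY⟩ := hEC.exists_isMEC
  have hYW : Y ⊆ W := h.saturated Y hY b (hBY hb) (hBD hb).1
  -- By saturation the MEC `Y` around `B` stays in `W`, where no path leaves `B`. Hence `Y` is `B`,
  -- and the exit that the winning region grants to `Y` contradicts the closure of `B`.
  have hYB : Y ⊆ B := by
    intro y hy
    have hpath := hY.prop.1 b (hBY hb) y hy
    clear hy
    induction hpath with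
    | refl => exact hb
    | tail _ h2 ih => exact hcl' _ ih _ (hYW h2.2.1) h2.2.2
  obtain ⟨u, hu, w, hw, hwY, he⟩ := h.exit Y hY hYW
    (Set.disjoint_left.2 fun y hy => hDT y (hBD (hYB hy)))
  exact hwY (hBY (hcl' u (hYB hu) w hw he))

/-- A potential on a winning region that player 1 can double in every step in expectation. -/
structure Potential [Fintype V] (P : MDP V) (T W : Set V) (g : V → ℝ) : Prop where
  nonneg : ∀ v, 0 ≤ g v
  le_one : ∀ v, g v ≤ 1
  mem : ∀ v, 0 < g v → v ∈ W
  target : ∀ v ∈ T ∩ W, 0 < g v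
  random : ∀ v (hr : v ∈ P.random), v ∈ W → v ∉ T → 2 * g v ≤ ∑ w, (P.δ ⟨v, hr⟩ w).toReal * g w
  player : ∀ v, v ∉ P.random → 0 < g v → v ∉ T → ∃ w, P.edge v w ∧ 2 * g v ≤ g w

/-- Give `v` half of what one step to `w` guarantees: `g w / 2` for player 1, and `g w / 2` times
the probability of `w` for a random vertex. All other inequalities persist because `g` only grows,
from `0`, at the vertex `v`. -/
theorem Potential.extend [Fintype V] {g : V → ℝ} (hg : Potential P T W g) {v w : V}
    (hv : v ∈ W) (hgv : g v = 0) (hT : v ∉ T) (hgw : 0 < g w) (he : P.edge v w) :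
    ∃ g', Potential P T W g' ∧ {u | 0 < g u} ⊆ {u | 0 < g' u} ∧ 0 < g' v := by
  classical
  have key : ∀ a : ℝ, 0 < a → a ≤ 1 →
      (∀ hr : v ∈ P.random, 2 * a ≤ ∑ w, (P.δ ⟨v, hr⟩ w).toReal * g w) → 2 * a ≤ g w →
      ∃ g', Potential P T W g' ∧ {u | 0 < g u} ⊆ {u | 0 < g' u} ∧ 0 < g' v := by
    intro a ha ha1 hra hpa
    have hge : ∀ u, g u ≤ Function.update g v a u := by
      intro u
      by_cases hu : u = v
      · subst hu; simp [hgv, ha.le]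
      · simp [Function.update_of_ne hu]
    refine ⟨Function.update g v a, ⟨fun u => (hg.nonneg u).trans (hge u), fun u => ?_,
      fun u hu => ?_, fun u hu => (hg.target u hu).trans_le (hge u), fun u hr hu huT => ?_,
      fun u hr hu huT => ?_⟩, fun u hu => lt_of_lt_of_le hu (hge u), by simp [ha]⟩
    · by_cases hu : u = v
      · subst hu; simpa using ha1
      · simpa [Function.update_of_ne hu] using hg.le_one u
    · by_cases huv : u = v
      · exact huv ▸ hv
      · exact hg.mem u (by simpa [Function.update_of_ne huv] using hu)
    · refine le_trans (b := ∑ w, (P.δ ⟨u, hr⟩ w).toReal * g w) ?_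
        (Finset.sum_le_sum fun i _ => mul_le_mul_of_nonneg_left (hge i) ENNReal.toReal_nonneg)
      by_cases huv : u = v
      · subst huv; simpa using hra hr
      · simpa [Function.update_of_ne huv] using hg.random u hr hu huT
    · by_cases huv : u = v
      · subst huv
        exact ⟨w, he, by simpa using hpa.trans (hge w)⟩
      · rw [Function.update_of_ne huv] at hu ⊢
        obtain ⟨x, hx, hx'⟩ := hg.player u hr hu huT
        exact ⟨x, hx, hx'.trans (hge x)⟩
  by_cases hr : v ∈ P.random
  · have hp : 0 < (P.δ ⟨v, hr⟩ w).toReal :=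
      ENNReal.toReal_pos ((P.edge_iff ⟨v, hr⟩ w).1 he).ne' (PMF.apply_ne_top _ _)
    have hp1 : (P.δ ⟨v, hr⟩ w).toReal ≤ 1 :=
      ENNReal.toReal_le_of_le_ofReal zero_le_one (by simpa using PMF.coe_le_one _ _)
    have hle : (P.δ ⟨v, hr⟩ w).toReal * g w ≤ g w := by nlinarith
    have h1 := hg.le_one w
    refine key ((P.δ ⟨v, hr⟩ w).toReal * g w / 2) (by positivity) (by linarith) (fun _ => ?_)
      (by linarith)
    rw [mul_div_cancel₀ _ two_ne_zero]
    exact Finset.single_le_sum (f := fun x => (P.δ ⟨v, hr⟩ x).toReal * g x)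
      (fun i _ => mul_nonneg ENNReal.toReal_nonneg (hg.nonneg i)) (Finset.mem_univ w)
  · have h1 := hg.le_one w
    exact key (g w / 2) (by positivity) (by linarith) (fun h => absurd h hr) (by linarith)

/-- Start from the indicator of `T ∩ W` and take a potential with maximal support. If the support
missed part of `W`, `exists_progress` would supply a vertex at which `Potential.extend` enlarges it.
-/
theorem exists_potential [Fintype V] (h : P.IsWinningRegion T W) :
    ∃ g, Potential P T W g ∧ ∀ v ∈ W, 0 < g v := by
  classical
  have hne : ({G | ∃ g, Potential P T W g ∧ {u | 0 < g u} = G} : Set (Set V)).Nonempty := by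
    refine ⟨_, fun v => if v ∈ T ∩ W then 1 else 0, ⟨fun v => ?_, fun v => ?_, fun v hv => ?_,
      fun v hv => ?_, fun v hr hv hvT => ?_, fun v hr hv hvT => ?_⟩, rfl⟩
    · split_ifs <;> simp
    · split_ifs <;> simp
    · by_contra hvW
      simp [hvW] at hv
    · simp only [if_pos hv]
      exact zero_lt_one
    · have : v ∉ T ∩ W := fun h => hvT h.1
      simp only [if_neg this, mul_zero]
      refine Finset.sum_nonneg fun w _ => mul_nonneg ENNReal.toReal_nonneg ?_
      split_ifs <;> simp
    · simp [hvT] at hv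
  obtain ⟨G, hG⟩ := (Set.toFinite
    ({G | ∃ g, Potential P T W g ∧ {u | 0 < g u} = G} : Set (Set V))).exists_maximal hne
  obtain ⟨g, hg, rfl⟩ := hG.prop
  refine ⟨g, hg, ?_⟩
  by_contra hcon
  have hGW : {u | 0 < g u} ≠ W := by
    intro heq
    exact hcon fun v hv => by rw [← heq] at hv; exact hv
  obtain ⟨v, hv, hvG, hvT, w, hw, he⟩ :=
    h.exists_progress (fun u hu => hg.mem u hu) (fun u hu => hg.target u hu) hGW
  have hgv : g v = 0 := le_antisymm (not_lt.1 hvG) (hg.nonneg v)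
  obtain ⟨g', hg', hsub, hv'⟩ := hg.extend hv hgv hvT hw he
  exact hvG (hG.le_of_ge ⟨g', hg', rfl⟩ hsub hv')

/-- Player 1 always moves to a successor where `g` has at least doubled. With a positive lower bound
`ε` for `g` on `W`, the function `2 - g` then contracts in expectation. -/
theorem mem_almostSure [Finite V] [MeasurableSpace V] [DiscreteMeasurableSpace V]
    (h : P.IsWinningRegion T W) {v : V} (hv : v ∈ W) : v ∈ P.almostSure (P.reach T) := by
  classical
  have := Fintype.ofFinite V
  obtain ⟨g, hg, hpos⟩ := h.exists_potential
  obtain ⟨ε, hε0, hε1, hε⟩ : ∃ ε : ℝ, 0 < ε ∧ ε ≤ 1 ∧ ∀ u ∈ W, ε ≤ g u := by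
    obtain ⟨u, hu, hmin⟩ := (Set.toFinite W).exists_minimalFor g W ⟨v, hv⟩
    refine ⟨g u, hpos u hu, hg.le_one u, fun x hx => ?_⟩
    rcases le_total (g u) (g x) with h1 | h1
    · exact h1
    · exact hmin hx h1
  have hf : ∀ u, ∃ w, (u ∉ P.random → P.edge u w) ∧
      (u ∉ P.random → u ∈ W → u ∉ T → 2 * g u ≤ g w) := by
    intro u
    by_cases hu : u ∉ P.random ∧ u ∈ W ∧ u ∉ T
    · obtain ⟨w, h1, h2⟩ := hg.player u hu.1 (hpos u hu.2.1) hu.2.2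
      exact ⟨w, fun _ => h1, fun _ _ _ => h2⟩
    · obtain ⟨w, hw⟩ := P.exists_edge u
      exact ⟨w, fun _ => hw, fun h1 h2 h3 => absurd ⟨h1, h2, h3⟩ hu⟩
  choose f hf1 hf2 using hf
  -- The value `⊤` outside `W` makes the contraction inequalities trivial there; plays from `W` do
  -- not see it before they reach `T`.
  let k : V → ENNReal := fun u => if u ∈ T then 0 else if u ∈ W then ENNReal.ofReal (2 - g u) else ⊤
  have hkW : ∀ u ∈ W, k u ≤ ENNReal.ofReal (2 - g u) := by
    intro u hu
    simp only [k, if_pos hu]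
    split_ifs <;> simp
  have hk' : ∀ u, u ∉ T → u ∈ W → k u = ENNReal.ofReal (2 - g u) := by
    intro u hT hu
    simp [k, hT, hu]
  have hc0 : ENNReal.ofReal (1 - ε / 2) ≠ 0 := by
    simp only [ne_eq, ENNReal.ofReal_eq_zero, not_le]
    linarith
  have hkT : ∀ u, u ∉ T → u ∉ W → ENNReal.ofReal (1 - ε / 2) * k u = ⊤ := by
    intro u hT hu
    simp only [k, if_neg hT, if_neg hu]
    exact ENNReal.mul_top hc0
  -- The difference `(1 - ε / 2) * (2 - g u) - (2 - 2 * g u)` equals `g u - ε + ε * g u / 2`, which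
  -- is nonnegative since `ε ≤ g u`.
  have hreal : ∀ u ∈ W, u ∉ T → ENNReal.ofReal (2 - 2 * g u) ≤
      ENNReal.ofReal (1 - ε / 2) * k u := by
    intro u hu hT
    rw [hk' u hT hu, ← ENNReal.ofReal_mul (by linarith)]
    refine ENNReal.ofReal_le_ofReal ?_
    have h1 := hε u hu
    have h2 := hg.le_one u
    nlinarith
  refine P.mem_almostSure_reach k (ENNReal.ofReal (1 - ε / 2)) ?_ ?_ f hf1 ?_ ?_ ?_
  · rw [ENNReal.ofReal_lt_one]
    linarith
  · intro u hT
    simp only [k, if_neg hT]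
    split_ifs
    · rw [ENNReal.one_le_ofReal]
      linarith [hg.le_one u]
    · exact le_top
  · intro u hr hT
    by_cases hu : u ∈ W
    · refine le_trans ?_ (hreal u hu hT)
      rw [tsum_fintype]
      have h1 : ∀ w, P.δ ⟨u, hr⟩ w * k w ≤
          ENNReal.ofReal ((P.δ ⟨u, hr⟩ w).toReal * (2 - g w)) := by
        intro w
        by_cases he : P.edge u w
        · rw [ENNReal.ofReal_mul ENNReal.toReal_nonneg,
            ENNReal.ofReal_toReal (PMF.apply_ne_top _ _)]
          gcongr
          exact hkW w (h.random' hu hT hr he)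
        · rw [P.edge_iff ⟨u, hr⟩] at he
          have : P.δ ⟨u, hr⟩ w = 0 := by simpa using he
          simp [this]
      refine (Finset.sum_le_sum fun w _ => h1 w).trans ?_
      rw [← ENNReal.ofReal_sum_of_nonneg
        (fun w _ => mul_nonneg ENNReal.toReal_nonneg (by linarith [hg.le_one w]))]
      refine ENNReal.ofReal_le_ofReal ?_
      have h2 := hg.random u hr hu hT
      have h3 : ∑ w, (P.δ ⟨u, hr⟩ w).toReal = 1 := by
        rw [← ENNReal.toReal_sum (fun w _ => PMF.apply_ne_top _ _), ← tsum_fintype (L := .unconditional V), PMF.tsum_coe]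
        simp
      simp only [mul_sub, Finset.sum_sub_distrib, ← Finset.sum_mul, h3]
      linarith
    · rw [hkT u hT hu]
      exact le_top
  · intro u hr hT
    by_cases hu : u ∈ W
    · refine le_trans ?_ (hreal u hu hT)
      have h1 := hf2 u hr hu hT
      have h2 : f u ∈ W := hg.mem _ (lt_of_lt_of_le (by linarith [hpos u hu]) h1)
      exact (hkW _ h2).trans (ENNReal.ofReal_le_ofReal (by linarith))
    · rw [hkT u hT hu]
      exact le_top
  · exact ne_top_of_le_ne_top ENNReal.ofReal_ne_top (hkW v hv)

end IsWinningRegion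

/-- A certificate that player 1 cannot win almost surely from the vertices whose class (under
`rep`) belongs to `G`. -/
structure LosingPotential (P : MDP V) (T : Set V) (rep : V → V) (G : Set V) (φ : V → ENNReal) :
    Prop where
  ne_top : ∀ v, φ v ≠ ⊤
  ne_zero_iff : ∀ v, φ v ≠ 0 ↔ rep v ∈ G
  target : ∀ v ∈ T, φ v = 0
  random : ∀ v (hv : v ∈ P.random), φ v ≤ ∑' w, P.δ ⟨v, hv⟩ w * φ w
  player : ∀ v, v ∉ P.random → ∀ w, P.edge v w → φ v ≤ φ w

/-- Assign to the class `c` one constant `d`, so small that a single edge into `G` from a random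
vertex already contributes `d` to the expectation. A common value on the class is harmless for the
edges inside it, and the old inequalities persist since `φ` was `0` on `c`. -/
theorem LosingPotential.extend [Finite V] {P : MDP V} {T : Set V} {rep : V → V} {G : Set V}
    {φ : V → ENNReal} (hφ : P.LosingPotential T rep G φ) {c : V} (hc : c ∉ G)
    (hT : ∀ v, rep v = c → v ∉ T)
    (hr : ∀ v, rep v = c → v ∈ P.random → (∃ w, P.edge v w ∧ rep w ∈ G) ∨
      ∀ w, P.edge v w → rep w ∈ insert c G)
    (hp : ∀ v, rep v = c → v ∉ P.random → ∀ w, P.edge v w → rep w ∈ insert c G) :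
    ∃ φ', P.LosingPotential T rep (insert c G) φ' := by
  classical
  -- The bound is taken simultaneously over the positive values of `φ` and the positive products of
  -- a transition probability with a value of `φ`.
  obtain ⟨d, hd0, hd1, hd⟩ := ENNReal.exists_pos_le_of_ne_zero
    (fun i : V ⊕ ({v : V // v ∈ P.random} × V) =>
      Sum.elim φ (fun p => P.δ p.1 p.2 * φ p.2) i)
  have hdφ : ∀ v, φ v ≠ 0 → d ≤ φ v := fun v hv => hd (Sum.inl v) hv
  have hge : ∀ w, φ w ≤ if rep w = c then d else φ w := by
    intro w
    split_ifs with h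
    · have : φ w = 0 := by
        by_contra h0
        exact hc (h ▸ (hφ.ne_zero_iff w).1 h0)
      simp [this]
    · exact le_rfl
  have hgd : ∀ w, rep w ∈ insert c G → d ≤ if rep w = c then d else φ w := by
    intro w hw
    split_ifs with h
    · exact le_rfl
    · exact hdφ w ((hφ.ne_zero_iff w).2 (hw.resolve_left h))
  refine ⟨fun v => if rep v = c then d else φ v, fun v => ?_, fun v => ?_, fun v hv => ?_,
    fun v hv => ?_, fun v hv w he => ?_⟩
  · split_ifs
    · exact ne_top_of_le_ne_top ENNReal.one_ne_top hd1
    · exact hφ.ne_top v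
  · split_ifs with h
    · simp [hd0, h]
    · rw [hφ.ne_zero_iff, Set.mem_insert_iff, or_iff_right h]
  · have : rep v ≠ c := fun h => hT v h hv
    simp [this, hφ.target v hv]
  · split_ifs with h
    · rcases hr v h hv with ⟨w, he, hw⟩ | hall
      · refine le_trans ?_ (ENNReal.le_tsum w)
        refine le_trans ?_ (mul_le_mul_right (hge w) _)
        refine hd (Sum.inr (⟨v, hv⟩, w)) ?_
        simp only [Sum.elim_inr]
        exact mul_ne_zero ((P.edge_iff ⟨v, hv⟩ w).1 he).ne' ((hφ.ne_zero_iff w).2 hw)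
      -- All successors have value at least `d`, and so does their average.
      · calc d = ∑' w, P.δ ⟨v, hv⟩ w * d := by
              rw [ENNReal.tsum_mul_right, PMF.tsum_coe, one_mul]
          _ ≤ _ := by
              refine ENNReal.tsum_le_tsum fun w => ?_
              by_cases he : P.edge v w
              · exact mul_le_mul_right (hgd w (hall w he)) _
              · rw [P.edge_iff ⟨v, hv⟩] at he
                have : P.δ ⟨v, hv⟩ w = 0 := by simpa using he
                simp [this]
    · exact (hφ.random v hv).trans
        (ENNReal.tsum_le_tsum fun w => mul_le_mul_right (hge w) _)
  · by_cases h : rep v = c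
    · rw [if_pos h]
      exact hgd w (hp v h hv w he)
    · rw [if_neg h]
      exact (hφ.player v hv w he).trans (hge w)

/-- Let `A` be a set of classes (under `rep`) that can be exhausted by adding, one after the other,
classes from which player 1 is forced into the classes already present. Then player 1 cannot win
almost surely from the vertices in `A`. -/
theorem notMem_almostSure_of_forced [Finite V] [MeasurableSpace V] [DiscreteMeasurableSpace V]
    (P : MDP V) {T : Set V} {rep : V → V} {A : Set V}
    (hA : ∀ G, G ⊆ A → G ≠ A → ∃ c ∈ A, c ∉ G ∧ ∀ v, rep v = c → v ∉ T ∧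
      (v ∈ P.random → (∃ w, P.edge v w ∧ rep w ∈ G) ∨ ∀ w, P.edge v w → rep w ∈ insert c G) ∧
      (v ∉ P.random → ∀ w, P.edge v w → rep w ∈ insert c G))
    {v : V} (hv : rep v ∈ A) : v ∉ P.almostSure (P.reach T) := by
  -- A maximal certified subset of `A` replaces an iteration; the empty set is certified by the zero
  -- function.
  have hne : ({G | G ⊆ A ∧ ∃ φ, P.LosingPotential T rep G φ} : Set (Set V)).Nonempty :=
    ⟨∅, Set.empty_subset _, fun _ => 0, by constructor <;> simp⟩
  obtain ⟨G, hG⟩ := (Set.toFinite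
    ({G | G ⊆ A ∧ ∃ φ, P.LosingPotential T rep G φ} : Set (Set V))).exists_maximal hne
  obtain ⟨hGA, φ, hφ⟩ := hG.prop
  by_cases hGeq : G = A
  · exact P.notMem_almostSure_reach φ hφ.ne_top hφ.target hφ.random hφ.player
      ((hφ.ne_zero_iff v).2 (hGeq ▸ hv))
  · obtain ⟨c, hcA, hcG, hc⟩ := hA G hGA hGeq
    obtain ⟨φ', hφ'⟩ := hφ.extend hcG (fun u hu => (hc u hu).1) (fun u hu => (hc u hu).2.1)
      (fun u hu => (hc u hu).2.2)
    exact absurd (hG.le_of_ge ⟨Set.insert_subset hcA hGA, φ', hφ'⟩ (Set.subset_insert c G)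
      (Set.mem_insert c G)) hcG

end Graph

end MDP

/-! ### Disjointness of maximal end-components -/

namespace MDP

/-- Paths between the two sets are routed through the common vertex `x`. Hence distinct MECs are
disjoint, and contracting them makes sense. -/
theorem IsEC.union {V : Type*} {P : MDP V} {X Y : Set V} (hX : P.IsEC X) (hY : P.IsEC Y) {x : V}
    (hxX : x ∈ X) (hxY : x ∈ Y) : P.IsEC (X ∪ Y) := by
  have hpath : ∀ Z, P.IsEC Z → Z ⊆ X ∪ Y → ∀ u ∈ Z, ∀ v ∈ Z,
      Relation.ReflTransGen (fun a b => a ∈ X ∪ Y ∧ b ∈ X ∪ Y ∧ P.edge a b) u v :=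
    fun Z hZ hsub u hu v hv => Relation.ReflTransGen.mono
      (fun a b h => ⟨hsub h.1, hsub h.2.1, h.2.2⟩) u v (hZ.1 u hu v hv)
  refine ⟨fun u hu v hv => Relation.ReflTransGen.trans (b := x) ?_ ?_, fun v hv hr w he => ?_, ?_⟩
  · rcases hu with hu | hu
    · exact hpath X hX Set.subset_union_left u hu x hxX
    · exact hpath Y hY Set.subset_union_right u hu x hxY
  · rcases hv with hv | hv
    · exact hpath X hX Set.subset_union_left x hxX v hv
    · exact hpath Y hY Set.subset_union_right x hxY v hv
  · exact hv.imp (fun hv => hX.2.1 v hv hr w he) (fun hv => hY.2.1 v hv hr w he)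
  · obtain ⟨u, hu, v, hv, he⟩ := hX.2.2
    exact ⟨u, Or.inl hu, v, Or.inl hv, he⟩

theorem IsMEC.eq_of_mem {V : Type*} {P : MDP V} {X Y : Set V} (hX : P.IsMEC X) (hY : P.IsMEC Y)
    {x : V} (hxX : x ∈ X) (hxY : x ∈ Y) : X = Y := by
  have h := hX.prop.union hY.prop hxX hxY
  exact (hX.eq_of_subset h Set.subset_union_left).trans
    (hY.eq_of_subset h Set.subset_union_right).symm

end MDP

/-! ## Threshold systems on a contracted graph -/

open Classical in
/-- The number of edges `e < m` from the class `c` to a different class in `B`; `S e` and `D e` are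
the classes of the source and of the target of `e`. -/
noncomputable def exitCount (m : ℕ) (S D : ℕ → ℕ) (B : Set ℕ) (c : ℕ) : ℕ :=
  ((Finset.range m).filter fun e => S e ≠ D e ∧ S e = c ∧ D e ∈ B).card

theorem exitCount_mono {m : ℕ} {S D : ℕ → ℕ} {B B' : Set ℕ} (h : B ⊆ B') (c : ℕ) :
    exitCount m S D B c ≤ exitCount m S D B' c := by
  classical
  unfold exitCount
  refine Finset.card_le_card fun e he => ?_
  simp only [Finset.mem_filter] at he ⊢
  exact ⟨he.1, he.2.1, he.2.2.1, h he.2.2.2⟩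

theorem exitCount_le (m : ℕ) (S D : ℕ → ℕ) (B : Set ℕ) (c : ℕ) : exitCount m S D B c ≤ m := by
  classical
  exact (Finset.card_filter_le _ _).trans (by simp)

theorem one_le_exitCount {m : ℕ} {S D : ℕ → ℕ} {B : Set ℕ} {c : ℕ} :
    1 ≤ exitCount m S D B c ↔ ∃ e < m, S e ≠ D e ∧ S e = c ∧ D e ∈ B := by
  classical
  unfold exitCount
  rw [Nat.one_le_iff_ne_zero, Finset.card_ne_zero]
  simp [Finset.Nonempty]

/-- This expresses "all leaving edges go to `B`" as a threshold condition, so that it has the same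
form as the rule for random vertices. -/
theorem exitCount_univ_le {m : ℕ} {S D : ℕ → ℕ} {B : Set ℕ} {c : ℕ} :
    exitCount m S D Set.univ c ≤ exitCount m S D B c ↔
      ∀ e < m, S e ≠ D e → S e = c → D e ∈ B := by
  classical
  unfold exitCount
  constructor
  · intro h e he hne hS
    have hsub : (Finset.range m).filter (fun e => S e ≠ D e ∧ S e = c ∧ D e ∈ B) ⊆
        (Finset.range m).filter (fun e => S e ≠ D e ∧ S e = c ∧ D e ∈ (Set.univ : Set ℕ)) := by
      intro e he
      simp only [Finset.mem_filter] at he ⊢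
      exact ⟨he.1, he.2.1, he.2.2.1, trivial⟩
    have heq := Finset.eq_of_subset_of_card_le hsub (by convert h)
    have hmem : e ∈ (Finset.range m).filter (fun e => S e ≠ D e ∧ S e = c ∧ D e ∈ B) := by
      rw [heq]
      simp only [Finset.mem_filter, Finset.mem_range, Set.mem_univ, and_true]
      exact ⟨he, hne, hS⟩
    exact (Finset.mem_filter.1 hmem).2.2.2
  · intro h
    refine Finset.card_le_card fun e he => ?_
    simp only [Finset.mem_filter, Finset.mem_range] at he ⊢
    exact ⟨he.1, he.2.1, he.2.2.1, h e he.1 he.2.1 he.2.2.1⟩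

/-- `A` is the least set of numbers below `n` that contains every `c` with at least `thr c` edges
into `A`. -/
structure IsLeastThreshold (n m : ℕ) (S D thr : ℕ → ℕ) (A : Set ℕ) : Prop where
  fixed : ∀ c < n, c ∈ A ↔ thr c ≤ exitCount m S D A c
  least : ∀ B : Set ℕ, (∀ c < n, thr c ≤ exitCount m S D B c → c ∈ B) → ∀ c < n, c ∈ A → c ∈ B

/-- `rep` chooses a representative from each maximal end-component (given by the labelling `lab`),
and fixes the vertices outside the maximal end-components. -/
structure IsRepresentative (n : ℕ) (lab rep : ℕ → ℕ) : Prop where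
  of_zero : ∀ v < n, lab v = 0 → rep v = v
  lt : ∀ v < n, rep v < n
  lab_rep : ∀ v < n, lab (rep v) = lab v
  congr : ∀ u < n, ∀ v < n, lab u ≠ 0 → lab u = lab v → rep u = rep v

/-- `lab` is a labelling of the vertices by maximal end-components. -/
structure IsMECLabelling {n : ℕ} (P : MDP (Fin n)) (lab : ℕ → ℕ) : Prop where
  ne_zero_iff : ∀ v : Fin n, lab v ≠ 0 ↔ ∃ X, P.IsMEC X ∧ v ∈ X
  eq_iff : ∀ u v : Fin n, lab u ≠ 0 → lab v ≠ 0 →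
    (lab u = lab v ↔ ∃ X, P.IsMEC X ∧ u ∈ X ∧ v ∈ X)

theorem IsMECLabelling.mem_iff {n : ℕ} {P : MDP (Fin n)} {lab : ℕ → ℕ} (h : IsMECLabelling P lab)
    {X : Set (Fin n)} (hX : P.IsMEC X) {u v : Fin n} (hu : u ∈ X) : lab v = lab u ↔ v ∈ X := by
  have hu0 : lab u ≠ 0 := (h.ne_zero_iff u).2 ⟨X, hX, hu⟩
  constructor
  · intro hv
    obtain ⟨Y, hY, hvY, huY⟩ := (h.eq_iff v u (hv ▸ hu0) hu0).1 hv
    exact hY.eq_of_mem hX huY hu ▸ hvY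
  · intro hv
    exact (h.eq_iff v u ((h.ne_zero_iff v).2 ⟨X, hX, hv⟩) hu0).2 ⟨X, hX, hv, hu⟩

open Classical in
/-- The number of edges into the losing region that put the class `c` into the losing region. -/
noncomputable def loseThreshold {n : ℕ} (P : MDP (Fin n)) (m : ℕ) (S D lab rep : ℕ → ℕ)
    (T : Set (Fin n)) (c : ℕ) : ℕ :=
  if ∃ t ∈ T, rep t = c then m + 1
  else if lab c = 0 ∧ ∃ r ∈ P.random, (r : ℕ) = c then 1
  else exitCount m S D Set.univ c

/-! ### The least threshold set consists of the losing classes -/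

section Reduction

variable {n m : ℕ} {P : MDP (Fin n)} {src dst S D lab rep : ℕ → ℕ} {T : Set (Fin n)} {A : Set ℕ}

/-- Each condition on a winning region is the failure of a threshold: fewer than one edge into `A`
means that no edge of a random vertex leads there, and fewer than all leaving edges means that some
exit avoids `A`. Only the fixed point property of `A` matters here, not its leastness. -/
theorem isWinningRegion_compl_threshold
    (hE : ∀ e < m, ∃ u w : Fin n, src e = u ∧ dst e = w ∧ P.edge u w)
    (hE' : ∀ u w : Fin n, P.edge u w → ∃ e < m, src e = u ∧ dst e = w)
    (hS : ∀ e < m, S e = rep (src e)) (hD : ∀ e < m, D e = rep (dst e))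
    (hlab : IsMECLabelling P lab) (hrep : IsRepresentative n lab rep)
    (hA : IsLeastThreshold n m S D (loseThreshold P m S D lab rep T) A) :
    P.IsWinningRegion T {v | rep v ∉ A} := by
  have hlab0 : ∀ v : Fin n, (∀ X, P.IsMEC X → v ∉ X) → lab v = 0 := by
    intro v hv
    by_contra h0
    obtain ⟨X, hX, hvX⟩ := (hlab.ne_zero_iff v).1 h0
    exact hv X hX hvX
  have hrepeq : ∀ v u : Fin n, lab v = 0 → rep u = v → u = v := by
    intro v u hv hu
    have h1 := hrep.lab_rep u u.2
    rw [hu, hv] at h1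
    have h2 := hrep.of_zero u u.2 h1.symm
    exact Fin.ext (h2.symm.trans hu)
  have hnoT : ∀ v : Fin n, lab v = 0 → v ∉ T → ¬ ∃ t ∈ T, rep t = v := by
    rintro v hv hvT ⟨t, ht, hteq⟩
    exact hvT (hrepeq v t hv hteq ▸ ht)
  constructor
  · intro X hX u hu huW x hx
    have h1 := (hlab.mem_iff hX hu).2 hx
    have h2 := hrep.congr u u.2 x x.2 ((hlab.ne_zero_iff u).2 ⟨X, hX, hu⟩) h1.symm
    exact fun h => huW (h2 ▸ h)
  · intro v hv hvT hr hX w he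
    have h0 := hlab0 v hX
    have hvv := hrep.of_zero v v.2 h0
    intro hwA
    apply hv
    rw [hvv, hA.fixed v v.2, loseThreshold, if_neg (hnoT v h0 hvT), if_pos ⟨h0, v, hr, rfl⟩,
      one_le_exitCount]
    obtain ⟨e, hem, hes, hed⟩ := hE' v w he
    refine ⟨e, hem, ?_, ?_, ?_⟩
    · rw [hS e hem, hD e hem, hes, hed]
      intro h
      exact hv (h ▸ hwA)
    · rw [hS e hem, hes, hvv]
    · rw [hD e hem, hed]
      exact hwA
  · intro v hv hvT hr hX
    have h0 := hlab0 v hX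
    have hvv := hrep.of_zero v v.2 h0
    by_contra hcon
    push Not at hcon
    apply hv
    rw [hvv, hA.fixed v v.2, loseThreshold, if_neg (hnoT v h0 hvT), if_neg, exitCount_univ_le]
    · intro e hem _ hSe
      obtain ⟨u, w, hu, hw, he⟩ := hE e hem
      rw [hS e hem, hu] at hSe
      obtain rfl := hrepeq v u h0 hSe
      by_contra hDA
      rw [hD e hem, hw] at hDA
      exact hcon w hDA he
    · rintro ⟨_, r, hr', hrv⟩
      exact hr (Fin.ext hrv ▸ hr')
  · intro X hX hXW hXT
    obtain ⟨x, hx, _⟩ := hX.prop.2.2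
    have hx0 : lab x ≠ 0 := (hlab.ne_zero_iff x).2 ⟨X, hX, hx⟩
    -- The class of a vertex of a MEC lies inside that MEC, so an edge found to leave the class has
    -- its source in `X`, and disjointness from `T` excludes the threshold `m + 1`.
    have hclass : ∀ u : Fin n, rep u = rep x → u ∈ X := by
      intro u hu
      have h1 := hrep.lab_rep u u.2
      rw [hu, hrep.lab_rep x x.2] at h1
      exact (hlab.mem_iff hX hx).1 h1.symm
    have hnot : ¬ loseThreshold P m S D lab rep T (rep x) ≤ exitCount m S D A (rep x) :=
      fun h => hXW hx ((hA.fixed _ (hrep.lt x x.2)).2 h)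
    rw [loseThreshold, if_neg, if_neg, exitCount_univ_le] at hnot
    · push Not at hnot
      obtain ⟨e, hem, hne, hSe, hDe⟩ := hnot
      obtain ⟨u, w, hu, hw, he⟩ := hE e hem
      rw [hS e hem, hu] at hSe
      rw [hD e hem, hw] at hDe
      rw [hS e hem, hD e hem, hu, hw] at hne
      refine ⟨u, hclass u hSe, w, hDe, fun hwX => hne ?_, he⟩
      rw [hSe]
      exact hrep.congr x x.2 w w.2 hx0 ((hlab.mem_iff hX hx).2 hwX).symm
    · rintro ⟨h, _⟩
      exact hx0 ((hrep.lab_rep x x.2).symm.trans h)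
    · rintro ⟨t, ht, htx⟩
      exact Set.disjoint_left.1 hXT (hclass t htx) ht

/-- Here leastness is what counts: a proper subset `G` of `A` cannot be closed under the threshold
rule, and a class that violates closure is forced into `G`. That the classes are MECs plays no role
in this direction. -/
theorem notMem_almostSure_of_threshold
    (hE : ∀ e < m, ∃ u w : Fin n, src e = u ∧ dst e = w ∧ P.edge u w)
    (hE' : ∀ u w : Fin n, P.edge u w → ∃ e < m, src e = u ∧ dst e = w)
    (hS : ∀ e < m, S e = rep (src e)) (hD : ∀ e < m, D e = rep (dst e))
    (hrep : IsRepresentative n lab rep)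
    (hA : IsLeastThreshold n m S D (loseThreshold P m S D lab rep T) A)
    {v : Fin n} (hv : rep v ∈ A) : v ∉ P.almostSure (P.reach T) := by
  refine P.notMem_almostSure_of_forced (rep := fun v => ⟨rep v, hrep.lt v v.2⟩)
    (A := {c | (c : ℕ) ∈ A}) ?_ hv
  intro G hGA hGne
  have hGA' : {c | ∃ h : c < n, (⟨c, h⟩ : Fin n) ∈ G} ⊆ A := by
    rintro c ⟨_, h⟩
    exact hGA h
  -- If `G` were closed under the rule, leastness would give `A ⊆ G` below `n`.
  have hcl : ¬ ∀ c < n, loseThreshold P m S D lab rep T c ≤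
      exitCount m S D {c | ∃ h : c < n, ⟨c, h⟩ ∈ G} c → c ∈ {c | ∃ h : c < n, ⟨c, h⟩ ∈ G} := by
    intro hcl
    refine hGne (Set.Subset.antisymm hGA fun c hc => ?_)
    exact (hA.least _ hcl c c.2 hc).2
  push Not at hcl
  obtain ⟨c, hcn, hthr, hcG⟩ := hcl
  have hcG' : (⟨c, hcn⟩ : Fin n) ∉ G := fun h => hcG ⟨hcn, h⟩
  have hcA : c ∈ A := (hA.fixed c hcn).2 (hthr.trans (exitCount_mono hGA' c))
  refine ⟨⟨c, hcn⟩, hcA, hcG', fun v hv => ?_⟩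
  have hvc : rep v = c := congrArg Fin.val hv
  have hT : ¬ ∃ t ∈ T, rep t = c := by
    intro h
    rw [loseThreshold, if_pos h] at hthr
    exact absurd (exitCount_le m S D {c | ∃ h : c < n, ⟨c, h⟩ ∈ G} c) (by omega)
  have heq : ∀ u : Fin n, lab c = 0 → rep u = c → (u : ℕ) = c := by
    intro u h0 hu
    have h1 := hrep.lab_rep u u.2
    rw [hu, h0] at h1
    exact (hrep.of_zero u u.2 h1.symm).symm.trans hu
  rw [loseThreshold, if_neg hT] at hthr
  have hforced : ¬ (lab c = 0 ∧ ∃ r ∈ P.random, (r : ℕ) = c) → ∀ w, P.edge v w →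
      (⟨rep w, hrep.lt w w.2⟩ : Fin n) ∈ insert (⟨c, hcn⟩ : Fin n) G := by
    intro hcase w he
    rw [if_neg hcase, exitCount_univ_le] at hthr
    obtain ⟨e, hem, hes, hed⟩ := hE' v w he
    by_cases hwc : rep w = c
    · exact Or.inl (Fin.ext hwc)
    · refine Or.inr ?_
      have h1 := hthr e hem (by rw [hS e hem, hD e hem, hes, hed, hvc]; exact fun h => hwc h.symm)
        (by rw [hS e hem, hes, hvc])
      rw [hD e hem, hed] at h1
      exact h1.2
  refine ⟨fun hvT => hT ⟨v, hvT, hvc⟩, fun hr => ?_, fun hr => hforced ?_⟩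
  · by_cases hcase : lab c = 0 ∧ ∃ r ∈ P.random, (r : ℕ) = c
    · left
      rw [if_pos hcase, one_le_exitCount] at hthr
      obtain ⟨e, hem, _, hSe, hDe⟩ := hthr
      obtain ⟨u, w, hu, hw, he⟩ := hE e hem
      rw [hS e hem, hu] at hSe
      rw [hD e hem, hw] at hDe
      have huv : u = v := Fin.ext ((heq u hcase.1 hSe).trans (heq v hcase.1 hvc).symm)
      exact ⟨w, huv ▸ he, hDe.2⟩
    · exact Or.inr (hforced hcase)
  · rintro ⟨h0, r, hr', hrc⟩
    exact hr (Fin.ext ((heq v h0 hvc).trans hrc.symm) ▸ hr')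

theorem mem_almostSure_iff_threshold
    (hE : ∀ e < m, ∃ u w : Fin n, src e = u ∧ dst e = w ∧ P.edge u w)
    (hE' : ∀ u w : Fin n, P.edge u w → ∃ e < m, src e = u ∧ dst e = w)
    (hS : ∀ e < m, S e = rep (src e)) (hD : ∀ e < m, D e = rep (dst e))
    (hlab : IsMECLabelling P lab) (hrep : IsRepresentative n lab rep)
    (hA : IsLeastThreshold n m S D (loseThreshold P m S D lab rep T) A) (v : Fin n) :
    v ∈ P.almostSure (P.reach T) ↔ rep v ∉ A := by
  refine ⟨fun h hv => notMem_almostSure_of_threshold hE hE' hS hD hrep hA hv h, fun h => ?_⟩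
  exact (isWinningRegion_compl_threshold hE hE' hS hD hlab hrep hA).mem_almostSure h

end Reduction

namespace RAM

infixr:60 " ;; " => Prog.seq

/-! ### Total correctness with time -/

/-- The program `p`, started in `s`, halts in some store `s'` after `t` steps such that `Q s' t`. -/
def Runs (p : Prog) (s : Store) (Q : Store → ℕ → Prop) : Prop :=
  ∃ s' t, Exec p s s' t ∧ Q s' t

theorem Runs.mono {p : Prog} {s : Store} {Q Q' : Store → ℕ → Prop} (h : Runs p s Q)
    (hQ : ∀ s' t, Q s' t → Q' s' t) : Runs p s Q' := by
  obtain ⟨s', t, h1, h2⟩ := h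
  exact ⟨s', t, h1, hQ s' t h2⟩

theorem runs_instr {c : Instr} {s : Store} {Q : Store → ℕ → Prop} :
    Runs (.instr c) s Q ↔ Q (c.apply s) 1 := by
  constructor
  · rintro ⟨s', t, h1, h2⟩
    cases h1
    exact h2
  · exact fun h => ⟨_, _, .instr c s, h⟩

theorem runs_seq {p q : Prog} {s : Store} {Q : Store → ℕ → Prop} :
    Runs (p ;; q) s Q ↔ Runs p s fun s₁ t₁ => Runs q s₁ fun s₂ t₂ => Q s₂ (t₁ + t₂) := by
  constructor
  · rintro ⟨s', t, h1, h2⟩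
    cases h1 with
    | seq h3 h4 => exact ⟨_, _, h3, _, _, h4, h2⟩
  · rintro ⟨_, _, h3, _, _, h4, h2⟩
    exact ⟨_, _, .seq h3 h4, h2⟩

theorem runs_ite {b : Test} {p q : Prog} {s : Store} {Q : Store → ℕ → Prop} :
    Runs (.ite b p q) s Q ↔ (b.Holds s → Runs p s fun s' t => Q s' (t + 1)) ∧
      (¬ b.Holds s → Runs q s fun s' t => Q s' (t + 1)) := by
  constructor
  · rintro ⟨s', t, h1, h2⟩
    cases h1 with
    | ite_true hb h3 => exact ⟨fun _ => ⟨_, _, h3, h2⟩, fun h => absurd hb h⟩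
    | ite_false hb h3 => exact ⟨fun h => absurd h hb, fun _ => ⟨_, _, h3, h2⟩⟩
  · rintro ⟨h1, h2⟩
    by_cases hb : b.Holds s
    · obtain ⟨s', t, h3, h4⟩ := h1 hb
      exact ⟨_, _, .ite_true hb h3, h4⟩
    · obtain ⟨s', t, h3, h4⟩ := h2 hb
      exact ⟨_, _, .ite_false hb h3, h4⟩

/-! ### What a program can change -/

/-- Whether an instruction writes the register `r`. -/
def Instr.writesReg : Instr → ℕ → Bool
  | .skip, _ => false
  | .const x _, r => x == r
  | .copy x _, r => x == r
  | .add x _ _, r => x == r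
  | .sub x _ _, r => x == r
  | .load x _ _, r => x == r
  | .store _ _ _, _ => false

/-- Whether an instruction writes the array `a`. -/
def Instr.writesArr : Instr → ℕ → Bool
  | .store b _ _, a => b == a
  | _, _ => false

/-- Whether the register `r` is written somewhere in a program. -/
def Prog.writesReg : Prog → ℕ → Bool
  | .instr c, r => c.writesReg r
  | .seq p q, r => p.writesReg r || q.writesReg r
  | .ite _ p q, r => p.writesReg r || q.writesReg r
  | .loop _ p, r => p.writesReg r

/-- Whether the array `a` is written somewhere in a program. -/
def Prog.writesArr : Prog → ℕ → Bool
  | .instr c, a => c.writesArr a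
  | .seq p q, a => p.writesArr a || q.writesArr a
  | .ite _ p q, a => p.writesArr a || q.writesArr a
  | .loop _ p, a => p.writesArr a

/-- The stores `s` and `s'` differ at most in what `p` writes. -/
structure Frame (p : Prog) (s s' : Store) : Prop where
  reg : ∀ r, p.writesReg r = false → s'.reg r = s.reg r
  arr : ∀ a, p.writesArr a = false → s'.arr a = s.arr a

theorem Frame.refl (p : Prog) (s : Store) : Frame p s s :=
  ⟨fun _ _ => rfl, fun _ _ => rfl⟩

theorem Frame.trans {p : Prog} {s s' s'' : Store} (h : Frame p s s') (h' : Frame p s' s'') :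
    Frame p s s'' :=
  ⟨fun r hr => (h'.reg r hr).trans (h.reg r hr), fun a ha => (h'.arr a ha).trans (h.arr a ha)⟩

/-- A syntactic check bounds what a run can change, so facts about untouched registers and arrays
pass through whole subprograms by evaluating a Boolean. -/
theorem Exec.frame {p : Prog} {s s' : Store} {t : ℕ} (h : Exec p s s' t) : Frame p s s' := by
  induction h with
  | instr c s =>
    constructor
    · intro r hr
      cases c <;> simp only [Prog.writesReg, Instr.writesReg, beq_eq_false_iff_ne] at hr <;>
        simp only [Instr.apply] <;> rw [Function.update_of_ne (Ne.symm hr)]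
    · intro a ha
      cases c <;> simp only [Prog.writesArr, Instr.writesArr, beq_eq_false_iff_ne] at ha <;>
        simp only [Instr.apply]
      rw [Function.update_of_ne (Ne.symm ha)]
  | seq h1 h2 ih1 ih2 =>
    constructor
    · intro r hr
      simp only [Prog.writesReg, Bool.or_eq_false_iff] at hr
      rw [ih2.reg r hr.2, ih1.reg r hr.1]
    · intro a ha
      simp only [Prog.writesArr, Bool.or_eq_false_iff] at ha
      rw [ih2.arr a ha.2, ih1.arr a ha.1]
  | ite_true hb h ih =>
    constructor
    · intro r hr
      simp only [Prog.writesReg, Bool.or_eq_false_iff] at hr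
      exact ih.reg r hr.1
    · intro a ha
      simp only [Prog.writesArr, Bool.or_eq_false_iff] at ha
      exact ih.arr a ha.1
  | ite_false hb h ih =>
    constructor
    · intro r hr
      simp only [Prog.writesReg, Bool.or_eq_false_iff] at hr
      exact ih.reg r hr.2
    · intro a ha
      simp only [Prog.writesArr, Bool.or_eq_false_iff] at ha
      exact ih.arr a ha.2
  | loop_false hb => exact Frame.refl _ _
  | loop_true hb h1 h2 ih1 ih2 =>
    exact Frame.trans ⟨ih1.reg, ih1.arr⟩ ih2

theorem Runs.frame {p : Prog} {s : Store} {Q : Store → ℕ → Prop} (h : Runs p s Q) :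
    Runs p s fun s' t => Q s' t ∧ Frame p s s' := by
  obtain ⟨s', t, h1, h2⟩ := h
  exact ⟨s', t, h1, h2, h1.frame⟩

/-! ### Loops -/

/-- A loop whose invariant carries a bound `a` on the remaining time. -/
theorem Runs.loop {b : Test} {p : Prog} {I : ℕ → Store → Prop} {s₀ : Store}
    (hbody : ∀ a s, Frame p s₀ s → I a s → b.Holds s →
      Runs p s fun s' t => ∃ a', I a' s' ∧ t + a' + 1 ≤ a)
    {a : ℕ} (h0 : I a s₀) :
    Runs (.loop b p) s₀ fun s' t => t ≤ a + 1 ∧ ¬ b.Holds s' ∧ ∃ a', I a' s' := by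
  suffices h : ∀ a s, Frame p s₀ s → I a s →
      Runs (.loop b p) s fun s' t => t ≤ a + 1 ∧ ¬ b.Holds s' ∧ ∃ a', I a' s' from
    h a s₀ (Frame.refl _ _) h0
  intro a
  induction a using Nat.strong_induction_on with
  | _ a ih =>
    intro s hs hI
    by_cases hb : b.Holds s
    · obtain ⟨s', t, h1, a', h2, h3⟩ := hbody a s hs hI hb
      obtain ⟨s'', t', h4, h5, h6⟩ := ih a' (by omega) s' (hs.trans h1.frame) h2
      exact ⟨s'', _, .loop_true hb h1 h4, by omega, h6⟩
    · exact ⟨s, 1, .loop_false hb, by omega, hb, a, hI⟩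

/-- A counting loop: register `i` runs up to the content `b` of register `x`. -/
theorem Runs.for_loop {i x : ℕ} {p : Prog} {I : ℕ → Store → Prop} {s₀ : Store} {j₀ b c : ℕ}
    (hI : ∀ j s, I j s → s.reg i = j) (hb : s₀.reg x = b) (hx : p.writesReg x = false)
    (hbody : ∀ j s, Frame p s₀ s → j₀ ≤ j → j < b → I j s →
      Runs p s fun s' t => I (j + 1) s' ∧ t ≤ c)
    (hj : j₀ ≤ b) (h0 : I j₀ s₀) :
    Runs (.loop (.lt i x) p) s₀ fun s' t => I b s' ∧ t ≤ (b - j₀) * (c + 1) + 1 := by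
  suffices h : ∀ d j s, d + j = b → j₀ ≤ j → Frame p s₀ s → I j s →
      Runs (.loop (.lt i x) p) s fun s' t => I b s' ∧ t ≤ d * (c + 1) + 1 from
    h (b - j₀) j₀ s₀ (by omega) le_rfl (Frame.refl _ _) h0
  intro d
  induction d with
  | zero =>
    intro j s hd _ hs hIs
    obtain rfl : j = b := by omega
    refine ⟨s, 1, .loop_false ?_, hIs, by omega⟩
    simp [Test.Holds, hI _ _ hIs, hs.reg x hx, hb]
  | succ d ih =>
    intro j s hd hj hs hIs
    obtain ⟨s', t, h1, h2, h3⟩ := hbody j s hs hj (by omega) hIs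
    obtain ⟨s'', t', h4, h5, h6⟩ := ih (j + 1) s' (by omega) (by omega) (hs.trans h1.frame) h2
    refine ⟨s'', _, .loop_true ?_ h1 h4, h5, ?_⟩
    · simp only [Test.Holds, hI _ _ hIs, hs.reg x hx, hb]
      omega
    · rw [Nat.add_mul]
      omega

/-! ### Relocation -/

/-- Shift all registers and arrays of an instruction by `d`. -/
def Instr.shift (d : ℕ) : Instr → Instr
  | .skip => .skip
  | .const x c => .const (x + d) c
  | .copy x y => .copy (x + d) (y + d)
  | .add x y z => .add (x + d) (y + d) (z + d)
  | .sub x y z => .sub (x + d) (y + d) (z + d)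
  | .load x a i => .load (x + d) (a + d) (i + d)
  | .store a i x => .store (a + d) (i + d) (x + d)

/-- Shift all registers of a test by `d`. -/
def Test.shift (d : ℕ) : Test → Test
  | .lt x y => .lt (x + d) (y + d)
  | .eq x y => .eq (x + d) (y + d)

/-- Shift all registers and arrays of a program by `d`. -/
def Prog.shift (d : ℕ) : Prog → Prog
  | .instr c => .instr (c.shift d)
  | .seq p q => .seq (p.shift d) (q.shift d)
  | .ite b p q => .ite (b.shift d) (p.shift d) (q.shift d)
  | .loop b p => .loop (b.shift d) (p.shift d)

/-- The store `s` occurs in `s'` at the offset `d`. -/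
structure Embedded (d : ℕ) (s s' : Store) : Prop where
  reg : ∀ r, s'.reg (r + d) = s.reg r
  arr : ∀ a, s'.arr (a + d) = s.arr a

theorem Embedded.apply {d : ℕ} {s s' : Store} (h : Embedded d s s') (c : Instr) :
    Embedded d (c.apply s) ((c.shift d).apply s') := by
  cases c <;> constructor <;> intro r <;>
    simp [Instr.apply, Instr.shift, Function.update_apply, h.reg, h.arr]

theorem Embedded.holds_iff {d : ℕ} {s s' : Store} (h : Embedded d s s') (b : Test) :
    (b.shift d).Holds s' ↔ b.Holds s := by
  cases b <;> simp [Test.Holds, Test.shift, h.reg]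

/-- A relocated program simulates the original step by step and in the same time. This allows an
arbitrary decomposition program to be used without overwriting the data kept below the offset. -/
theorem Exec.shift {p : Prog} {s s₁ : Store} {t : ℕ} (h : Exec p s s₁ t) (d : ℕ) {s' : Store}
    (hs : Embedded d s s') : ∃ s₁', Exec (p.shift d) s' s₁' t ∧ Embedded d s₁ s₁' := by
  induction h generalizing s' with
  | instr c s => exact ⟨_, .instr _ _, hs.apply c⟩
  | seq h1 h2 ih1 ih2 =>
    obtain ⟨_, h3, h4⟩ := ih1 hs
    obtain ⟨_, h5, h6⟩ := ih2 h4
    exact ⟨_, .seq h3 h5, h6⟩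
  | ite_true hb h ih =>
    obtain ⟨_, h3, h4⟩ := ih hs
    exact ⟨_, .ite_true ((hs.holds_iff _).2 hb) h3, h4⟩
  | ite_false hb h ih =>
    obtain ⟨_, h3, h4⟩ := ih hs
    exact ⟨_, .ite_false (mt (hs.holds_iff _).1 hb) h3, h4⟩
  | loop_false hb => exact ⟨_, .loop_false (mt (hs.holds_iff _).1 hb), hs⟩
  | loop_true hb h1 h2 ih1 ih2 =>
    obtain ⟨_, h3, h4⟩ := ih1 hs
    obtain ⟨_, h5, h6⟩ := ih2 h4
    exact ⟨_, .loop_true ((hs.holds_iff _).2 hb) h3 h5, h6⟩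

theorem Prog.writesReg_shift {d r : ℕ} (hr : r < d) (p : Prog) :
    (p.shift d).writesReg r = false := by
  induction p with
  | instr c => cases c <;> simp [Prog.shift, Prog.writesReg, Instr.shift, Instr.writesReg] <;> omega
  | seq p q ih1 ih2 => simp [Prog.shift, Prog.writesReg, ih1, ih2]
  | ite b p q ih1 ih2 => simp [Prog.shift, Prog.writesReg, ih1, ih2]
  | loop b p ih => simp [Prog.shift, Prog.writesReg, ih]

theorem Prog.writesArr_shift {d a : ℕ} (ha : a < d) (p : Prog) :
    (p.shift d).writesArr a = false := by
  induction p with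
  | instr c => cases c <;> simp [Prog.shift, Prog.writesArr, Instr.shift, Instr.writesArr]; omega
  | seq p q ih1 ih2 => simp [Prog.shift, Prog.writesArr, ih1, ih2]
  | ite b p q ih1 ih2 => simp [Prog.shift, Prog.writesArr, ih1, ih2]
  | loop b p ih => simp [Prog.shift, Prog.writesArr, ih]

theorem Exec.one_le {p : Prog} {s s' : Store} {t : ℕ} (h : Exec p s s' t) : 1 ≤ t := by
  induction h <;> omega

/-! ### Counting from zero

Register `4` holds the constant `1`; registers from `6` on are scratch registers. -/

/-- Run `p` for the values `0, 1, …` of register `6` below the content of register `x`. -/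
def forRange (x : ℕ) (p : Prog) : Prog :=
  .instr (.const 6 0) ;; .loop (.lt 6 x) (p ;; .instr (.add 6 6 4))

/-- The invariant has to ignore register `6`, because resetting and incrementing the counter happen
outside `p`. Each round costs `2` beyond the body, for the increment and the test. -/
theorem runs_forRange {x : ℕ} {p : Prog} {I : ℕ → Store → Prop} {s : Store} {b c : ℕ}
    (h4 : s.reg 4 = 1) (hx : s.reg x = b) (hx6 : x ≠ 6) (hpx : p.writesReg x = false)
    (hp6 : p.writesReg 6 = false) (hp4 : p.writesReg 4 = false)
    (hI : ∀ j s v, I j s → I j { s with reg := Function.update s.reg 6 v })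
    (hbody : ∀ j s', j < b → Frame (forRange x p) s s' → s'.reg 6 = j → I j s' →
      Runs p s' fun s'' t => I (j + 1) s'' ∧ t ≤ c)
    (h0 : I 0 s) : Runs (forRange x p) s fun s' t => I b s' ∧ t ≤ b * (c + 2) + 2 := by
  refine runs_seq.2 (runs_instr.2 ?_)
  have hloop := Runs.for_loop (i := 6) (x := x) (p := p ;; .instr (.add 6 6 4))
    (I := fun j s' => s'.reg 6 = j ∧ I j s') (s₀ := (Instr.const 6 0).apply s) (j₀ := 0) (b := b)
    (c := c + 1) (fun j s' h => h.1) ?_ ?_ ?_ (Nat.zero_le _) ⟨?_, ?_⟩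
  · refine hloop.mono fun s' t h => ⟨h.1.2, ?_⟩
    have := h.2
    simp only [Nat.sub_zero, add_assoc, Nat.reduceAdd] at this ⊢
    omega
  · simp [Instr.apply, Function.update_of_ne hx6, hx]
  · simp [Prog.writesReg, Instr.writesReg, hpx, hx6.symm]
  · rintro j s' hf - hj ⟨h6, hIj⟩
    have hf' : Frame (forRange x p) s s' := by
      refine Frame.trans (s' := (Instr.const 6 0).apply s) ⟨fun r hr => ?_, fun a ha => rfl⟩
        ⟨fun r hr => hf.reg r ?_, fun a ha => hf.arr a ?_⟩
      · simp only [forRange, Prog.writesReg, Instr.writesReg, Bool.or_eq_false_iff,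
          beq_eq_false_iff_ne] at hr
        simp [Instr.apply, Function.update_of_ne (Ne.symm hr.1)]
      · simp only [forRange, Prog.writesReg, Bool.or_eq_false_iff] at hr ⊢
        exact hr.2
      · simp only [forRange, Prog.writesArr, Bool.or_eq_false_iff] at ha ⊢
        exact ha.2
    rw [runs_seq]
    refine (hbody j s' hj hf' h6 hIj).frame.mono ?_
    rintro s'' t ⟨⟨h1, h2⟩, h3⟩
    rw [runs_instr]
    refine ⟨⟨?_, hI _ _ _ h1⟩, by omega⟩
    have h4' : s'.reg 4 = 1 := by
      rw [hf'.reg 4 (by simp [forRange, Prog.writesReg, Instr.writesReg, hp4]), h4]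
    simp [Instr.apply, h3.reg 6 hp6, h3.reg 4 hp4, h6, h4']
  · simp [Instr.apply]
  · exact hI _ _ _ h0

/-- Copy the first cells of the array `a` to the array `b`; register `x` holds their number. -/
def copyArr (x a b : ℕ) : Prog :=
  forRange x (.instr (.load 7 a 6) ;; .instr (.store b 6 7))

theorem runs_copyArr {x a b N : ℕ} {s : Store} (h4 : s.reg 4 = 1) (hx : s.reg x = N)
    (hx6 : x ≠ 6) (hx7 : x ≠ 7) (hab : a ≠ b) :
    Runs (copyArr x a b) s fun s' t =>
      (∀ i, s'.arr b i = if i < N then s.arr a i else s.arr b i) ∧ t ≤ N * 4 + 2 := by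
  refine runs_forRange (I := fun j s' => ∀ i, s'.arr b i = if i < j then s.arr a i else s.arr b i)
    h4 hx hx6 (by simp [Prog.writesReg, Instr.writesReg, hx7.symm]) rfl rfl
    (fun j s v h => h) ?_ (by simp)
  intro j s' hj hf h6 hb
  have ha := hf.arr a (by simp [forRange, Prog.writesArr, Instr.writesArr, hab.symm])
  simp only [runs_seq, runs_instr, Instr.apply]
  refine ⟨fun i => ?_, le_rfl⟩
  simp only [Function.update_apply, h6, ha]
  grind

end RAM

/-! ## Linked lists and stacks of linked lists -/

/-- `p` points to the list `l`: a pointer is `0` for the empty list and `e + 1` for a list with head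
`e`, and `next e` points to the tail. -/
def Linked (next : ℕ → ℕ) : ℕ → List ℕ → Prop
  | p, [] => p = 0
  | p, e :: l => p = e + 1 ∧ Linked next (next e) l

theorem Linked.congr {next next' : ℕ → ℕ} {p : ℕ} {l : List ℕ} (h : Linked next p l)
    (heq : ∀ e ∈ l, next' e = next e) : Linked next' p l := by
  induction l generalizing p with
  | nil => exact h
  | cons e l ih =>
    refine ⟨h.1, ?_⟩
    rw [heq e List.mem_cons_self]
    exact ih h.2 fun x hx => heq x (List.mem_cons_of_mem _ hx)

/-- The first cells of `stk` point to the lists in `st`, the last of these cells to the first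
list. -/
def LinkedStack (next stk : ℕ → ℕ) : List (List ℕ) → Prop
  | [] => True
  | l :: st => Linked next (stk st.length) l ∧ LinkedStack next stk st

theorem LinkedStack.congr {next stk stk' : ℕ → ℕ} {st : List (List ℕ)}
    (h : LinkedStack next stk st) (heq : ∀ i < st.length, stk' i = stk i) :
    LinkedStack next stk' st := by
  induction st with
  | nil => trivial
  | cons l st ih =>
    refine ⟨?_, ih h.2 fun i hi => heq i (by simp; omega)⟩
    rw [heq st.length (by simp)]
    exact h.1

theorem LinkedStack.update {next stk : ℕ → ℕ} {st : List (List ℕ)}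
    (h : LinkedStack next stk st) {p i : ℕ} (hi : i = st.length) {l : List ℕ}
    (hl : Linked next p l) : LinkedStack next (Function.update stk i p) (l :: st) := by
  subst hi
  refine ⟨by simpa using hl, h.congr fun i hi => ?_⟩
  rw [Function.update_of_ne (by omega)]

/-! ## The worklist computation of the least threshold set -/

/-- The edges `e < m` between different classes that end in the class `c`. -/
def inList (m : ℕ) (S D : ℕ → ℕ) (c : ℕ) : List ℕ :=
  ((List.range m).filter fun e => S e ≠ D e ∧ D e = c).reverse

theorem mem_inList {m : ℕ} {S D : ℕ → ℕ} {c e : ℕ} :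
    e ∈ inList m S D c ↔ e < m ∧ S e ≠ D e ∧ D e = c := by
  simp [inList]

theorem nodup_inList (m : ℕ) (S D : ℕ → ℕ) (c : ℕ) : (inList m S D c).Nodup :=
  List.nodup_reverse.2 (List.nodup_range.filter _)

/-- The reversal in `inList` puts the newest edge at the head, which matches prepending to a linked
list. -/
theorem inList_succ (m : ℕ) (S D : ℕ → ℕ) (c : ℕ) :
    inList (m + 1) S D c =
      if S m ≠ D m ∧ D m = c then m :: inList m S D c else inList m S D c := by
  simp only [inList, List.range_succ, List.filter_append, List.reverse_append]
  split_ifs with h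
  · rw [List.filter_cons_of_pos (by simpa using h)]
    rfl
  · rw [List.filter_cons_of_neg (by simpa using h)]
    rfl

theorem exitCount_univ_succ (m : ℕ) (S D : ℕ → ℕ) (c : ℕ) :
    exitCount (m + 1) S D Set.univ c =
      exitCount m S D Set.univ c + if S m ≠ D m ∧ S m = c then 1 else 0 := by
  classical
  unfold exitCount
  rw [Finset.range_add_one, Finset.filter_insert]
  split_ifs with h1 h2 h2
  · rw [Finset.card_insert_of_notMem (by simp)]
  · simp_all
  · simp_all
  · rfl

theorem exitCount_zero (S D : ℕ → ℕ) (B : Set ℕ) (c : ℕ) : exitCount 0 S D B c = 0 := by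
  simp [exitCount]

/-- The state of the computation: `need c` edges are still missing for the class `c`, the edges in
`seen` have been counted, those in `pend` have to be. -/
structure Worklist (n m : ℕ) (S D thr need : ℕ → ℕ) (seen : Finset ℕ) (pend : List ℕ) : Prop where
  mem_iff : ∀ e, (e ∈ seen ∨ e ∈ pend) ↔ e < m ∧ S e ≠ D e ∧ D e < n ∧ need (D e) = 0
  disjoint : ∀ e ∈ pend, e ∉ seen
  nodup : pend.Nodup
  need_eq : ∀ c < n, need c = thr c - (seen.filter fun e => S e = c).card
  least : ∀ B : Set ℕ, (∀ c < n, thr c ≤ exitCount m S D B c → c ∈ B) →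
    ∀ c < n, need c = 0 → c ∈ B

namespace Worklist

variable {n m : ℕ} {S D thr need : ℕ → ℕ} {seen : Finset ℕ} {pend : List ℕ}

theorem seen_card_le (h : Worklist n m S D thr need seen pend) : seen.card ≤ m := by
  have : seen ⊆ Finset.range m := fun e he =>
    Finset.mem_range.2 ((h.mem_iff e).1 (Or.inl he)).1
  simpa using Finset.card_le_card this

theorem card_filter_le (h : Worklist n m S D thr need seen pend) {B : Set ℕ}
    (hB : ∀ c < n, need c = 0 → c ∈ B) (c : ℕ) :
    (seen.filter fun e => S e = c).card ≤ exitCount m S D B c := by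
  classical
  unfold exitCount
  refine Finset.card_le_card fun e he => ?_
  rw [Finset.mem_filter] at he
  obtain ⟨h1, h2, h3, h4⟩ := (h.mem_iff e).1 (Or.inl he.1)
  simp only [Finset.mem_filter, Finset.mem_range]
  exact ⟨h1, h2, he.2, hB _ h3 h4⟩

theorem init (hneed : ∀ c < n, need c = thr c)
    (hpend : ∀ e, e ∈ pend ↔ e < m ∧ S e ≠ D e ∧ D e < n ∧ need (D e) = 0)
    (hnodup : pend.Nodup) : Worklist n m S D thr need ∅ pend where
  mem_iff := by simpa using hpend
  disjoint := by simp
  nodup := hnodup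
  need_eq := by simpa using hneed
  least B hB c hc h0 := hB c hc (by rw [← hneed c hc, h0]; exact Nat.zero_le _)

/-- With nothing pending, the counted edges are exactly those into the classes with `need = 0`, so
`need c = 0` says that the threshold of `c` is met by that very set. -/
theorem final (h : Worklist n m S D thr need seen []) :
    IsLeastThreshold n m S D thr {c | c < n ∧ need c = 0} := by
  classical
  have hcount : ∀ c, exitCount m S D {c | c < n ∧ need c = 0} c =
      (seen.filter fun e => S e = c).card := by
    intro c
    unfold exitCount
    congr 1
    ext e
    have := h.mem_iff e
    simp only [List.not_mem_nil, or_false] at this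
    simp only [Finset.mem_filter, Finset.mem_range, this, Set.mem_ofPred_eq]
    tauto
  constructor
  · intro c hc
    have := h.need_eq c hc
    rw [hcount]
    simp only [Set.mem_ofPred_eq]
    constructor
    · rintro ⟨_, h0⟩
      omega
    · intro h0
      exact ⟨hc, by omega⟩
  · intro B hB c hc hcA
    exact h.least B hB c hc hcA.2

theorem head_spec {e : ℕ} (h : Worklist n m S D thr need seen (e :: pend)) :
    e < m ∧ e ∉ seen ∧ e ∉ pend :=
  ⟨((h.mem_iff e).1 (Or.inr List.mem_cons_self)).1, h.disjoint e List.mem_cons_self,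
    (List.nodup_cons.1 h.nodup).1⟩

theorem need_eq_insert {e : ℕ} (h : Worklist n m S D thr need seen (e :: pend)) (c : ℕ)
    (hc : c < n) : Function.update need (S e) (need (S e) - 1) c =
      thr c - ((insert e seen).filter fun e => S e = c).card := by
  have h1 := h.need_eq c hc
  rw [Finset.filter_insert]
  by_cases hce : c = S e
  · subst hce
    rw [if_pos rfl, Finset.card_insert_of_notMem (by simp [h.head_spec.2.1]),
      Function.update_self]
    omega
  · rw [if_neg (Ne.symm hce), Function.update_of_ne hce, h1]

/-- Truncated subtraction keeps a class at `0` once it is there, and `need (S e) ≠ 1` rules out a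
new zero, so the set of classes found is unchanged. -/
theorem count {e : ℕ} (h : Worklist n m S D thr need seen (e :: pend)) (hne : need (S e) ≠ 1) :
    Worklist n m S D thr (Function.update need (S e) (need (S e) - 1)) (insert e seen) pend := by
  have hz : ∀ c, Function.update need (S e) (need (S e) - 1) c = 0 ↔ need c = 0 := by
    intro c
    by_cases hc : c = S e
    · subst hc
      rw [Function.update_self]
      omega
    · rw [Function.update_of_ne hc]
  refine ⟨fun x => ?_, fun x hx => ?_, (List.nodup_cons.1 h.nodup).2, h.need_eq_insert,
    fun B hB c hc h0 => h.least B hB c hc ((hz c).1 h0)⟩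
  · rw [hz, ← h.mem_iff x, Finset.mem_insert, List.mem_cons]
    tauto
  · rw [Finset.mem_insert, not_or]
    exact ⟨fun hxe => h.head_spec.2.2 (hxe ▸ hx), h.disjoint x (List.mem_cons_of_mem _ hx)⟩

/-- The class `S e` reaches `0` just now, so none of its incoming edges was seen or pending before;
this is why no edge is ever queued twice. -/
theorem add {e : ℕ} (h : Worklist n m S D thr need seen (e :: pend)) (hS : S e < n)
    (h1 : need (S e) = 1) :
    Worklist n m S D thr (Function.update need (S e) (need (S e) - 1)) (insert e seen)
      (inList m S D (S e) ++ pend) := by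
  have hz : ∀ c, Function.update need (S e) (need (S e) - 1) c = 0 ↔ need c = 0 ∨ c = S e := by
    intro c
    by_cases hc : c = S e
    · subst hc
      simp [h1]
    · simp [hc]
  have hnew : ∀ x ∈ inList m S D (S e), x ∉ seen ∧ x ∉ e :: pend := by
    intro x hx
    rw [mem_inList] at hx
    rw [← not_or, h.mem_iff x, hx.2.2, h1]
    simp
  refine ⟨fun x => ?_, fun x hx => ?_, ?_, h.need_eq_insert, fun B hB c hc h0 => ?_⟩
  · have h2 := h.mem_iff x
    rw [List.mem_cons] at h2
    rw [hz, Finset.mem_insert, List.mem_append, mem_inList]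
    constructor
    · rintro ((hx | hx) | (hx | hx))
      · have := h2.1 (Or.inr (Or.inl hx)); tauto
      · have := h2.1 (Or.inl hx); tauto
      · exact ⟨hx.1, hx.2.1, hx.2.2 ▸ hS, Or.inr hx.2.2⟩
      · have := h2.1 (Or.inr (Or.inr hx)); tauto
    · rintro ⟨h3, h4, h5, h6 | h6⟩
      · have := h2.2 ⟨h3, h4, h5, h6⟩; tauto
      · tauto
  · rw [Finset.mem_insert, not_or]
    rcases List.mem_append.1 hx with hx | hx
    · have := hnew x hx
      rw [List.mem_cons, not_or] at this
      exact ⟨this.2.1, this.1⟩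
    · exact ⟨fun hxe => h.head_spec.2.2 (hxe ▸ hx), h.disjoint x (List.mem_cons_of_mem _ hx)⟩
  · refine List.nodup_append'.2 ⟨nodup_inList _ _ _ _, (List.nodup_cons.1 h.nodup).2, ?_⟩
    intro x hx hx'
    exact (hnew x hx).2 (List.mem_cons_of_mem _ hx')
  · rcases (hz c).1 h0 with h0 | rfl
    · exact h.least B hB c hc h0
    -- The counted edges out of `S e` have reached its threshold, and they all end in classes found
    -- earlier, which lie in `B`.
    · refine hB _ hc ?_
      have h2 := h.need_eq_insert (S e) hc
      rw [Function.update_self, h1] at h2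
      refine le_trans (b := ((insert e seen).filter fun x => S x = S e).card) (by omega) ?_
      classical
      unfold exitCount
      refine Finset.card_le_card fun x hx => ?_
      simp only [Finset.mem_filter, Finset.mem_range, Finset.mem_insert] at hx ⊢
      obtain ⟨h3, h4, h5, h6⟩ := (h.mem_iff x).1 (by rw [List.mem_cons]; tauto)
      exact ⟨h3, h4, hx.2, h.least B hB _ h5 h6⟩

end Worklist

namespace RAM

/-! ## The program

Registers `0`, `1`, `2` hold the input numbers `n`, `m`, `k`; registers `3`, `4`, `5` hold `0`, `1`,
`m + 1`. The arrays `0` to `4` hold the input, `5` the output, `6` the representatives of the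
vertices, `7` for each label a vertex with this label, `8` the thresholds without targets, `9` and
`10` the linked lists of the edges into each representative, `11` the missing edges, `12` the stack,
`13` the representatives of the sources of the edges. Array `37` holds the labels. -/

/-- For each label find a vertex with this label. -/
def labelVertices : Prog :=
  forRange 0 (.instr (.load 7 37 6) ;; .instr (.store 7 7 6))

/-- The vertex processed last with a given label overwrites the others, so any two vertices with
this label read the same representative. Labels serve directly as addresses, hence their size is
irrelevant. -/
theorem runs_labelVertices {n : ℕ} {s : Store} (h0 : s.reg 0 = n) (h4 : s.reg 4 = 1) :
    Runs labelVertices s fun s' t =>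
      (∀ u < n, s'.arr 7 (s.arr 37 u) < n ∧ s.arr 37 (s'.arr 7 (s.arr 37 u)) = s.arr 37 u) ∧
        t ≤ n * 4 + 2 := by
  refine runs_forRange (I := fun j s' => ∀ u < j, s'.arr 7 (s.arr 37 u) < j ∧
    s.arr 37 (s'.arr 7 (s.arr 37 u)) = s.arr 37 u) h4 h0 (by decide) rfl rfl rfl
    (fun j s v h => h) ?_ (by simp)
  intro j s' hj hf h6 hI
  have ha := hf.arr 37 rfl
  simp only [runs_seq, runs_instr, Instr.apply]
  refine ⟨fun u hu => ?_, le_rfl⟩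
  simp only [Function.update_apply, h6, ha]
  grind

/-- Compute the representatives. -/
def representatives : Prog :=
  forRange 0 (.instr (.load 7 37 6) ;; .ite (.eq 7 3) (.instr (.store 6 6 6))
    (.instr (.load 7 7 7) ;; .instr (.store 6 6 7)))

theorem runs_representatives {n : ℕ} {s : Store} (h0 : s.reg 0 = n) (h3 : s.reg 3 = 0)
    (h4 : s.reg 4 = 1) :
    Runs representatives s fun s' t =>
      (∀ u < n, s'.arr 6 u = if s.arr 37 u = 0 then u else s.arr 7 (s.arr 37 u)) ∧
        t ≤ n * 6 + 2 := by
  refine runs_forRange (I := fun j s' => ∀ u < j,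
    s'.arr 6 u = if s.arr 37 u = 0 then u else s.arr 7 (s.arr 37 u)) h4 h0 (by decide) rfl rfl rfl
    (fun j s v h => h) ?_ (by simp)
  intro j s' hj hf h6 hI
  have ha := hf.arr 37 rfl
  have ha' := hf.arr 7 rfl
  have h3' := hf.reg 3 rfl
  simp only [runs_seq, runs_instr, runs_ite, Instr.apply, Test.Holds]
  simp only [Function.update_apply, h6, ha, ha', h3', h3]
  refine ⟨fun h => ⟨fun u hu => ?_, by omega⟩, fun h => ⟨fun u hu => ?_, by omega⟩⟩ <;> grind

/-- Count the edges that leave each class and list the edges that enter it. -/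
def edgeLists : Prog :=
  forRange 1 (.instr (.load 7 1 6) ;; .instr (.load 7 6 7) ;; .instr (.store 13 6 7) ;;
    .instr (.load 8 2 6) ;; .instr (.load 8 6 8) ;; .ite (.eq 7 8) (.instr .skip)
      (.instr (.load 9 8 7) ;; .instr (.add 9 9 4) ;; .instr (.store 8 7 9) ;;
        .instr (.load 9 9 8) ;; .instr (.store 10 6 9) ;; .instr (.add 9 6 4) ;;
        .instr (.store 9 8 9)))

/-- After `j` rounds the counts and lists are those of the first `j` edges. Since pointers are
shifted by one, the zeroed array `9` already holds empty lists. -/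
theorem runs_edgeLists {m : ℕ} {s : Store} (h1 : s.reg 1 = m) (h4 : s.reg 4 = 1)
    (h8 : ∀ c, s.arr 8 c = 0) (h9 : ∀ c, s.arr 9 c = 0) {S D : ℕ → ℕ}
    (hS : ∀ e, S e = s.arr 6 (s.arr 1 e)) (hD : ∀ e, D e = s.arr 6 (s.arr 2 e)) :
    Runs edgeLists s fun s' t =>
      ((∀ e < m, s'.arr 13 e = S e) ∧ (∀ c, s'.arr 8 c = exitCount m S D Set.univ c) ∧
        ∀ c, Linked (s'.arr 10) (s'.arr 9 c) (inList m S D c)) ∧ t ≤ m * 15 + 2 := by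
  refine runs_forRange (I := fun j s' => (∀ e < j, s'.arr 13 e = S e) ∧
    (∀ c, s'.arr 8 c = exitCount j S D Set.univ c) ∧
    ∀ c, Linked (s'.arr 10) (s'.arr 9 c) (inList j S D c)) h4 h1 (by decide) rfl rfl rfl
    (fun j s v h => h) ?_ ⟨by simp, by simp [h8, exitCount_zero], by simp [h9, inList, Linked]⟩
  rintro j s' hj hf h6 ⟨hI1, hI2, hI3⟩
  have ha1 := hf.arr 1 rfl
  have ha2 := hf.arr 2 rfl
  have ha6 := hf.arr 6 rfl
  have h4' := hf.reg 4 rfl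
  have hS' : s.arr 6 (s.arr 1 j) = S j := (hS j).symm
  have hD' : s.arr 6 (s.arr 2 j) = D j := (hD j).symm
  simp only [runs_seq, runs_instr, runs_ite, Instr.apply, Test.Holds]
  simp [h6, ha1, ha2, ha6, h4', h4, hS', hD', hI2]
  have h13 : ∀ e ≤ j, Function.update (s'.arr 13) j (S j) e = S e := by
    intro e he
    by_cases hej : e = j
    · subst hej
      simp
    · rw [Function.update_of_ne hej, hI1 e (by omega)]
  refine ⟨fun h => ⟨h13, fun c => ?_, fun c => ?_⟩, fun h => ⟨h13, fun c => ?_, fun c => ?_⟩⟩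
  · simp [exitCount_univ_succ, h]
  · simpa [inList_succ, h] using hI3 c
  · by_cases hc : c = S j
    · subst hc
      simp [exitCount_univ_succ, h]
    · simp [exitCount_univ_succ, hc, Ne.symm hc, hI2]
  · have hcong : ∀ c, Linked (Function.update (s'.arr 10) j (s'.arr 9 (D j))) (s'.arr 9 c)
        (inList j S D c) := fun c => (hI3 c).congr fun e he => by
      rw [Function.update_of_ne]
      have := (mem_inList.1 he).1
      omega
    rw [inList_succ]
    by_cases hc : c = D j
    · subst hc
      rw [if_pos ⟨h, rfl⟩]
      exact ⟨by simp, by simpa using hcong _⟩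
    · rw [if_neg (fun h' => hc h'.2.symm), Function.update_of_ne hc]
      exact hcong c

/-- The threshold of a random vertex outside the maximal end-components is `1`. -/
def randomThresholds : Prog :=
  forRange 0 (.instr (.load 7 37 6) ;; .ite (.eq 7 3)
    (.instr (.load 7 0 6) ;; .ite (.eq 7 4) (.instr (.store 8 6 4)) (.instr .skip))
    (.instr .skip))

theorem runs_randomThresholds {n : ℕ} {s : Store} (h0 : s.reg 0 = n) (h3 : s.reg 3 = 0)
    (h4 : s.reg 4 = 1) :
    Runs randomThresholds s fun s' t =>
      (∀ c, s'.arr 8 c = if c < n ∧ s.arr 37 c = 0 ∧ s.arr 0 c = 1 then 1 else s.arr 8 c) ∧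
        t ≤ n * 7 + 2 := by
  refine runs_forRange (I := fun j s' => ∀ c,
    s'.arr 8 c = if c < j ∧ s.arr 37 c = 0 ∧ s.arr 0 c = 1 then 1 else s.arr 8 c)
    h4 h0 (by decide) rfl rfl rfl (fun j s v h => h) ?_ (by simp)
  intro j s' hj hf h6 hI
  have ha := hf.arr 37 rfl
  have ha' := hf.arr 0 rfl
  have h3' := hf.reg 3 rfl
  have h4' := hf.reg 4 rfl
  simp only [runs_seq, runs_instr, runs_ite, Instr.apply, Test.Holds]
  simp [h6, ha, ha', h3', h3, h4', h4]
  refine ⟨fun h => ⟨fun h' c => ?_, fun h' c => ?_⟩, fun h c => ?_⟩ <;>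
    grind [Function.update_apply]

/-- Give the targets in the list number `reg 10` a threshold that is never met. -/
def markTargets : Prog :=
  .instr (.load 6 3 10) ;; .instr (.add 8 10 4) ;; .instr (.load 8 3 8) ;;
  .loop (.lt 6 8) (.instr (.load 7 4 6) ;; .instr (.load 7 6 7) ;; .instr (.store 11 7 5) ;;
    .instr (.add 6 6 4))

open Classical in
theorem runs_markTargets {i N lo hi : ℕ} {s : Store} (h4 : s.reg 4 = 1) (h5 : s.reg 5 = N)
    (h10 : s.reg 10 = i) (hlo : s.arr 3 i = lo) (hhi : s.arr 3 (i + 1) = hi) (hle : lo ≤ hi) :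
    Runs markTargets s fun s' t =>
      (∀ c, s'.arr 11 c =
        if ∃ j, lo ≤ j ∧ j < hi ∧ s.arr 6 (s.arr 4 j) = c then N else s.arr 11 c) ∧
        t ≤ (hi - lo) * 5 + 4 := by
  simp only [markTargets]
  rw [runs_seq, runs_instr, runs_seq, runs_instr, runs_seq, runs_instr]
  refine (Runs.for_loop (I := fun j s' => s'.reg 6 = j ∧ ∀ c, s'.arr 11 c =
    if ∃ j', lo ≤ j' ∧ j' < j ∧ s.arr 6 (s.arr 4 j') = c then N else s.arr 11 c)
    (j₀ := lo) (b := hi) (c := 4) (fun j s h => h.1) ?_ rfl ?_ hle ?_).mono ?_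
  · simp [Instr.apply, h10, h4, hhi]
  · rintro j s' hf hlj hj ⟨h6, hI⟩
    have ha4 := hf.arr 4 rfl
    have ha6 := hf.arr 6 rfl
    have h4' := hf.reg 4 rfl
    have h5' := hf.reg 5 rfl
    simp [Instr.apply] at ha4 ha6 h4' h5'
    simp only [runs_seq, runs_instr, Instr.apply]
    simp [h6, ha4, ha6, h4', h5', h4, h5]
    intro c
    by_cases hc : c = s.arr 6 (s.arr 4 j)
    · subst hc
      rw [Function.update_self, if_pos ⟨j, hlj, by omega, rfl⟩]
    · rw [Function.update_of_ne hc, hI]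
      refine if_congr (exists_congr fun x => ⟨fun h => ⟨h.1, by omega, h.2.2⟩, fun h => ?_⟩) rfl rfl
      refine ⟨h.1, ?_, h.2.2⟩
      have : x ≠ j := fun hxj => hc (hxj ▸ h.2.2.symm)
      omega
  · constructor
    · simp [Instr.apply, h10, hlo]
    · intro c
      rw [if_neg (by rintro ⟨x, h1, h2, _⟩; omega)]
      simp [Instr.apply]
  · rintro s' t ⟨⟨_, h⟩, ht⟩
    exact ⟨h, by omega⟩

/-- Put the edge lists of the classes without missing edges on the stack. -/
def initStack : Prog :=
  .instr (.const 9 0) ;; forRange 0 (.instr (.load 7 11 6) ;; .ite (.eq 7 3)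
    (.instr (.load 7 9 6) ;; .instr (.store 12 9 7) ;; .instr (.add 9 9 4)) (.instr .skip))

/-- The ghost list `z` records the classes found so far, with the latest on top of the stack. -/
theorem runs_initStack {n : ℕ} {s : Store} (h0 : s.reg 0 = n) (h3 : s.reg 3 = 0)
    (h4 : s.reg 4 = 1) {l : ℕ → List ℕ} (hl : ∀ c, Linked (s.arr 10) (s.arr 9 c) (l c)) :
    Runs initStack s fun s' t => (∃ z : List ℕ, z.Nodup ∧ z.length ≤ n ∧
      (∀ c, c ∈ z ↔ c < n ∧ s.arr 11 c = 0) ∧ s'.reg 9 = z.length ∧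
      LinkedStack (s.arr 10) (s'.arr 12) (z.map l)) ∧ t ≤ n * 7 + 3 := by
  refine runs_seq.2 (runs_instr.2 ?_)
  refine (runs_forRange (c := 5) (I := fun j s' => ∃ z : List ℕ, z.Nodup ∧ z.length ≤ j ∧
    (∀ c, c ∈ z ↔ c < j ∧ s.arr 11 c = 0) ∧ s'.reg 9 = z.length ∧
      LinkedStack (s.arr 10) (s'.arr 12) (z.map l)) ?_ ?_ (by decide) rfl rfl rfl
    ?_ ?_ ?_).mono fun s' t h => ⟨h.1, by omega⟩
  · simpa [Instr.apply] using h4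
  · simpa [Instr.apply] using h0
  · rintro j s v ⟨z, h1, h2, h3, h4, h5⟩
    exact ⟨z, h1, h2, h3, by simpa using h4, h5⟩
  · rintro j s' hj hf h6 ⟨z, hz1, hz2, hz3, hz4, hz5⟩
    have ha9 := hf.arr 9 rfl
    have ha11 := hf.arr 11 rfl
    have h3' := hf.reg 3 rfl
    have h4' := hf.reg 4 rfl
    simp [Instr.apply] at ha9 ha11 h3' h4'
    simp only [runs_seq, runs_instr, runs_ite, Instr.apply, Test.Holds]
    simp [h6, ha9, ha11, h3', h4', h3, h4, hz4]
    refine ⟨fun h => ⟨j :: z, ?_, by simp; omega, fun c => ?_, by simp, ?_⟩,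
      fun h => ⟨z, hz1, by omega, fun c => ?_, rfl, hz5⟩⟩
    · rw [List.nodup_cons]
      refine ⟨fun hjz => ?_, hz1⟩
      have := (hz3 j).1 hjz
      omega
    · rw [List.mem_cons, hz3]
      grind
    · rw [List.map_cons]
      exact hz5.update (by simp) (hl j)
    · rw [hz3]
      grind
  · exact ⟨[], by simp, by simp, by simp, by simp [Instr.apply], trivial⟩

/-- Count the edges on the stack, putting further edge lists on the stack. -/
def propagate : Prog :=
  .loop (.lt 3 9) (.instr (.sub 6 9 4) ;; .instr (.load 7 12 6) ;;
    .ite (.eq 7 3) (.instr (.copy 9 6))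
      (.instr (.sub 7 7 4) ;; .instr (.load 8 10 7) ;; .instr (.store 12 6 8) ;;
        .instr (.load 7 13 7) ;; .instr (.load 8 11 7) ;;
        .ite (.eq 8 4)
          (.instr (.load 6 9 7) ;; .instr (.store 12 9 6) ;; .instr (.add 9 9 4))
          (.instr .skip) ;;
        .instr (.sub 8 8 4) ;; .instr (.store 11 7 8)))

/-- The invariant of `propagate`, with a bound `a` on the remaining time. -/
def PropagateInv (n m : ℕ) (S D thr next : ℕ → ℕ) (a : ℕ) (s : Store) : Prop :=
  ∃ st seen, a = 15 * (2 * (m - Finset.card seen) + List.length st) ∧ s.reg 9 = st.length ∧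
    LinkedStack next (s.arr 12) st ∧ Worklist n m S D thr (s.arr 11) seen st.flatten

/-- One pass takes at most `15` steps including the loop test. It decreases twice the number of
uncounted edges plus the height of the stack: counting an edge saves `2` and pushes at most one
list, and popping an empty list saves `1`. -/
theorem runs_propagate {n m : ℕ} {S D thr : ℕ → ℕ} {st : List (List ℕ)} {s : Store}
    (h3 : s.reg 3 = 0) (h4 : s.reg 4 = 1) (hS : ∀ e < m, s.arr 13 e = S e) (hSn : ∀ e < m, S e < n)
    (hl : ∀ c, Linked (s.arr 10) (s.arr 9 c) (inList m S D c))
    (h9 : s.reg 9 = st.length) (hst : LinkedStack (s.arr 10) (s.arr 12) st)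
    (hW : Worklist n m S D thr (s.arr 11) ∅ st.flatten) :
    Runs propagate s fun s' t =>
      IsLeastThreshold n m S D thr {c | c < n ∧ s'.arr 11 c = 0} ∧
        t ≤ 15 * (2 * m + st.length) + 1 := by
  refine (Runs.loop (I := PropagateInv n m S D thr (s.arr 10)) ?_
    ⟨st, ∅, rfl, h9, hst, hW⟩).frame.mono ?_
  · rintro a s' hf ⟨st, seen, ha, h9, hst, hW⟩ hlt
    have ha9 := hf.arr 9 rfl
    have ha10 := hf.arr 10 rfl
    have ha13 := hf.arr 13 rfl
    have h3' := hf.reg 3 rfl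
    have h4' := hf.reg 4 rfl
    rw [h3] at h3'
    rw [h4] at h4'
    simp only [Test.Holds, h3', h9] at hlt
    obtain _ | ⟨l, st⟩ := st
    · simp at hlt
    obtain ⟨hl1, hst⟩ := hst
    simp only [List.length_cons] at h9 ha
    simp only [runs_seq, runs_instr, runs_ite, Instr.apply, Test.Holds]
    obtain _ | ⟨e, l⟩ := l
    · simp only [Linked] at hl1
      simp [h9, h4', h3', hl1]
      exact ⟨_, ⟨st, seen, rfl, by simp, hst, by simpa using hW⟩, by omega⟩
    · obtain ⟨hl1, hl2⟩ := hl1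
      have hsrc := hW.head_spec
      have hseen := hW.seen_card_le
      have hSe := hS e hsrc.1
      have hcard : (insert e seen).card = seen.card + 1 := Finset.card_insert_of_notMem hsrc.2.1
      simp [h9, h4', h3', hl1, ha10, ha13, ha9, hSe]
      refine ⟨fun h1 => ?_, fun h1 => ?_⟩
      -- The tail replaces the top entry of the stack, and the list of the new class goes above it.
      · have hW' := hW.add (hSn e hsrc.1) h1
        have hseen' := hW'.seen_card_le
        refine ⟨_, ⟨inList m S D (S e) :: l :: st, insert e seen, rfl, by simp, ?_,
          by simpa using hW'⟩, ?_⟩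
        · exact (hst.update rfl hl2).update (by simp) (hl (S e))
        · simp only [List.length_cons]
          omega
      · have hW' := hW.count h1
        have hseen' := hW'.seen_card_le
        refine ⟨_, ⟨l :: st, insert e seen, rfl, by simp [h9], hst.update rfl hl2,
          by simpa using hW'⟩, ?_⟩
        simp only [List.length_cons]
        omega
  · rintro s' t ⟨⟨ht, hb, a, st', seen, -, h9, -, hW⟩, hf⟩
    refine ⟨?_, by simpa using ht⟩
    have h3' := hf.reg 3 rfl
    simp only [Test.Holds, h3', h3, h9, not_lt, nonpos_iff_eq_zero, List.length_eq_zero_iff] at hb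
    subst hb
    exact hW.final

/-- Add the vertices whose class still misses an edge to the output. -/
def addWinning : Prog :=
  forRange 0 (.instr (.load 7 6 6) ;; .instr (.load 7 11 7) ;;
    .ite (.eq 7 3) (.instr .skip) (.instr (.store 5 6 4)))

theorem runs_addWinning {n : ℕ} {s : Store} (h0 : s.reg 0 = n) (h3 : s.reg 3 = 0)
    (h4 : s.reg 4 = 1) :
    Runs addWinning s fun s' t =>
      (∀ v, s'.arr 5 v = if v < n ∧ s.arr 11 (s.arr 6 v) ≠ 0 then 1 else s.arr 5 v) ∧
        t ≤ n * 6 + 2 := by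
  refine runs_forRange (I := fun j s' => ∀ v,
    s'.arr 5 v = if v < j ∧ s.arr 11 (s.arr 6 v) ≠ 0 then 1 else s.arr 5 v) h4 h0 (by decide)
    rfl rfl rfl (fun j s v h => h) ?_ (by simp)
  intro j s' hj hf h6 hI
  have ha := hf.arr 6 rfl
  have ha' := hf.arr 11 rfl
  have h3' := hf.reg 3 rfl
  have h4' := hf.reg 4 rfl
  simp only [runs_seq, runs_instr, runs_ite, Instr.apply, Test.Holds]
  simp [h6, ha, ha', h3', h3, h4', h4]
  refine ⟨fun h c => ?_, fun h c => ?_⟩ <;> grind [Function.update_apply]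

end RAM

/-! ### Preprocessing and the loop over the queries -/

namespace RAM

/-- Compute the winning set of the query number `reg 10` and add it to the output. -/
def solveQuery : Prog :=
  copyArr 0 8 11 ;; markTargets ;; initStack ;; propagate ;; addWinning

open Classical in
-- The base thresholds in array `8` are copied first, so only the copy is consumed. A list of
-- targets has length at most `n`, and at most `n` lists start on the stack, which keeps the time
-- linear in `n + m`.
theorem runs_solveQuery {n m i lo hi : ℕ} {S D : ℕ → ℕ} {s : Store} (h0 : s.reg 0 = n)
    (h3 : s.reg 3 = 0) (h4 : s.reg 4 = 1) (h5 : s.reg 5 = m + 1) (h10 : s.reg 10 = i)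
    (hS : ∀ e < m, s.arr 13 e = S e) (hSn : ∀ e < m, S e < n)
    (hl : ∀ c, Linked (s.arr 10) (s.arr 9 c) (inList m S D c))
    (hlo : s.arr 3 i = lo) (hhi : s.arr 3 (i + 1) = hi) (hle : lo ≤ hi) (hlen : hi - lo ≤ n) :
    Runs solveQuery s fun s' t =>
      (∃ A, IsLeastThreshold n m S D (fun c =>
          if ∃ j, lo ≤ j ∧ j < hi ∧ s.arr 6 (s.arr 4 j) = c then m + 1 else s.arr 8 c) A ∧
        ∀ v < n, s.arr 6 v < n → s'.arr 5 v = if s.arr 6 v ∈ A then s.arr 5 v else 1) ∧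
      t ≤ 37 * n + 30 * m + 12 := by
  refine runs_seq.2 ((runs_copyArr h4 h0 (by decide) (by decide) (by decide)).frame.mono ?_)
  rintro s₁ t₁ ⟨⟨hneed₁, ht₁⟩, hf₁⟩
  refine runs_seq.2 ((runs_markTargets (i := i) (N := m + 1) (lo := lo) (hi := hi)
    ?_ ?_ ?_ ?_ ?_ hle).frame.mono ?_)
  · rw [hf₁.reg 4 rfl, h4]
  · rw [hf₁.reg 5 rfl, h5]
  · rw [hf₁.reg 10 rfl, h10]
  · rw [hf₁.arr 3 rfl, hlo]
  · rw [hf₁.arr 3 rfl, hhi]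
  rintro s₂ t₂ ⟨⟨hneed₂, ht₂⟩, hf₂⟩
  rw [hf₁.arr 6 rfl, hf₁.arr 4 rfl] at hneed₂
  refine runs_seq.2 ((runs_initStack (n := n) (l := inList m S D) ?_ ?_ ?_ ?_).frame.mono ?_)
  · rw [hf₂.reg 0 rfl, hf₁.reg 0 rfl, h0]
  · rw [hf₂.reg 3 rfl, hf₁.reg 3 rfl, h3]
  · rw [hf₂.reg 4 rfl, hf₁.reg 4 rfl, h4]
  · rw [hf₂.arr 9 rfl, hf₁.arr 9 rfl, hf₂.arr 10 rfl, hf₁.arr 10 rfl]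
    exact hl
  rintro s₃ t₃ ⟨⟨⟨z, hz, hzn, hmem, hz9, hst⟩, ht₃⟩, hf₃⟩
  have ha10 : s₃.arr 10 = s₂.arr 10 := hf₃.arr 10 rfl
  have ha11 : s₃.arr 11 = s₂.arr 11 := hf₃.arr 11 rfl
  refine runs_seq.2 ((runs_propagate (n := n) (m := m) (S := S) (D := D) (st := z.map (inList m S D))
    (thr := fun c =>
      if ∃ j, lo ≤ j ∧ j < hi ∧ s.arr 6 (s.arr 4 j) = c then m + 1 else s.arr 8 c)
    ?_ ?_ ?_ hSn ?_ (by simpa using hz9) (by rw [ha10]; exact hst)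
    (Worklist.init ?_ ?_ ?_)).frame.mono ?_)
  · rw [hf₃.reg 3 rfl, hf₂.reg 3 rfl, hf₁.reg 3 rfl, h3]
  · rw [hf₃.reg 4 rfl, hf₂.reg 4 rfl, hf₁.reg 4 rfl, h4]
  · rw [hf₃.arr 13 rfl, hf₂.arr 13 rfl, hf₁.arr 13 rfl]
    exact hS
  · rw [ha10, hf₃.arr 9 rfl, hf₂.arr 9 rfl, hf₁.arr 9 rfl, hf₂.arr 10 rfl, hf₁.arr 10 rfl]
    exact hl
  · intro c hc
    rw [ha11, hneed₂, hneed₁, if_pos hc]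
  · intro e
    rw [ha11, ← List.flatMap_def, List.mem_flatMap]
    constructor
    · rintro ⟨c, hc, he⟩
      rw [mem_inList] at he
      obtain ⟨h6, h7, rfl⟩ := he
      exact ⟨h6, h7, (hmem _).1 hc⟩
    · rintro ⟨h6, h7, h8⟩
      exact ⟨D e, (hmem _).2 h8, mem_inList.2 ⟨h6, h7, rfl⟩⟩
  · rw [← List.flatMap_def, List.nodup_flatMap]
    refine ⟨fun c _ => nodup_inList _ _ _ _, hz.imp fun {a b} hab => ?_⟩
    intro e hea heb
    exact hab ((mem_inList.1 hea).2.2.symm.trans (mem_inList.1 heb).2.2)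
  rintro s₄ t₄ ⟨⟨hA, ht₄⟩, hf₄⟩
  refine (runs_addWinning (n := n) ?_ ?_ ?_).mono ?_
  · rw [hf₄.reg 0 rfl, hf₃.reg 0 rfl, hf₂.reg 0 rfl, hf₁.reg 0 rfl, h0]
  · rw [hf₄.reg 3 rfl, hf₃.reg 3 rfl, hf₂.reg 3 rfl, hf₁.reg 3 rfl, h3]
  · rw [hf₄.reg 4 rfl, hf₃.reg 4 rfl, hf₂.reg 4 rfl, hf₁.reg 4 rfl, h4]
  rintro s₅ t₅ ⟨hout, ht₅⟩
  rw [hf₄.arr 6 rfl, hf₃.arr 6 rfl, hf₂.arr 6 rfl, hf₁.arr 6 rfl,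
    hf₄.arr 5 rfl, hf₃.arr 5 rfl, hf₂.arr 5 rfl, hf₁.arr 5 rfl] at hout
  rw [List.length_map] at ht₄
  refine ⟨⟨_, hA, fun v hv hrv => ?_⟩, by omega⟩
  rw [hout v]
  simp only [hv, hrv, true_and, Set.mem_ofPred_eq]
  split_ifs <;> tauto

/-- Solve all queries. -/
def solveQueries : Prog :=
  .instr (.const 10 0) ;; .loop (.lt 10 2) (solveQuery ;; .instr (.add 10 10 4))

open Classical in
-- Queries only ever write `1` into the output, so it accumulates the union. The arrays `11` and
-- `12` need no clearing: one is copied afresh, and the other is read only below the current stack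
-- height.
theorem runs_solveQueries {n m k : ℕ} {S D : ℕ → ℕ} {s : Store} (h0 : s.reg 0 = n)
    (h2 : s.reg 2 = k) (h3 : s.reg 3 = 0) (h4 : s.reg 4 = 1) (h5 : s.reg 5 = m + 1)
    (hS : ∀ e < m, s.arr 13 e = S e) (hSn : ∀ e < m, S e < n)
    (hl : ∀ c, Linked (s.arr 10) (s.arr 9 c) (inList m S D c))
    (hle : ∀ i < k, s.arr 3 i ≤ s.arr 3 (i + 1))
    (hlen : ∀ i < k, s.arr 3 (i + 1) - s.arr 3 i ≤ n)
    (hrep : ∀ v < n, s.arr 6 v < n) (hout : ∀ v < n, s.arr 5 v = 0) {win : ℕ → ℕ → Prop}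
    (hwin : ∀ i < k, ∀ A, IsLeastThreshold n m S D (fun c =>
        if ∃ j, s.arr 3 i ≤ j ∧ j < s.arr 3 (i + 1) ∧ s.arr 6 (s.arr 4 j) = c then m + 1
        else s.arr 8 c) A →
      ∀ v < n, win i v ↔ s.arr 6 v ∉ A) :
    Runs solveQueries s fun s' t =>
      (∀ v < n, s'.arr 5 v = if ∃ i < k, win i v then 1 else 0) ∧
        t ≤ k * (37 * n + 30 * m + 14) + 2 := by
  refine runs_seq.2 (runs_instr.2 ?_)
  refine (Runs.for_loop (j₀ := 0) (b := k) (c := 37 * n + 30 * m + 13)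
    (I := fun j s' => s'.reg 10 = j ∧ ∀ v < n, s'.arr 5 v = if ∃ i < j, win i v then 1 else 0)
    (fun j s h => h.1) ?_ rfl ?_ (Nat.zero_le _) ?_).mono ?_
  · simpa [Instr.apply] using h2
  · rintro j s' hf - hj ⟨h10, hI⟩
    rw [runs_seq]
    have hr : ∀ r, r ≠ 10 → (solveQuery ;; .instr (.add 10 10 4)).writesReg r = false →
        s'.reg r = s.reg r := by
      intro r hr hw
      rw [hf.reg r hw]
      simp [Instr.apply, hr]
    have ha : ∀ a, (solveQuery ;; .instr (.add 10 10 4)).writesArr a = false →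
        s'.arr a = s.arr a := by
      intro a hw
      rw [hf.arr a hw]
      simp [Instr.apply]
    refine (runs_solveQuery (n := n) (m := m) (i := j) (S := S) (D := D) ?_ ?_ ?_ ?_ h10 ?_ hSn
      ?_ rfl rfl ?_ ?_).frame.mono ?_
    · rw [hr 0 (by decide) rfl, h0]
    · rw [hr 3 (by decide) rfl, h3]
    · rw [hr 4 (by decide) rfl, h4]
    · rw [hr 5 (by decide) rfl, h5]
    · rw [ha 13 rfl]
      exact hS
    · rw [ha 10 rfl, ha 9 rfl]
      exact hl
    · rw [ha 3 rfl]
      exact hle j hj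
    · rw [ha 3 rfl]
      exact hlen j hj
    rintro s'' t ⟨⟨⟨A, hA, hA'⟩, ht⟩, hf'⟩
    rw [ha 3 rfl, ha 4 rfl, ha 6 rfl, ha 8 rfl] at hA
    rw [ha 6 rfl] at hA'
    rw [runs_instr]
    refine ⟨⟨?_, fun v hv => ?_⟩, by omega⟩
    · simp [Instr.apply, hf'.reg 10 rfl, hf'.reg 4 rfl, h10, hr 4 (by decide) rfl, h4]
    · have hw := hwin j hj A hA v hv
      have heq : (∃ i < j + 1, win i v) ↔ (∃ i < j, win i v) ∨ win j v := by
        constructor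
        · rintro ⟨i, hi, hiw⟩
          rcases Nat.lt_succ_iff_lt_or_eq.1 hi with h | rfl
          · exact Or.inl ⟨i, h, hiw⟩
          · exact Or.inr hiw
        · rintro (⟨i, hi, hiw⟩ | h)
          · exact ⟨i, by omega, hiw⟩
          · exact ⟨j, by omega, h⟩
      simp only [Instr.apply]
      rw [hA' v hv (hrep v hv), hI v hv, if_congr heq rfl rfl]
      by_cases h1 : ∃ i < j, win i v <;> by_cases h2 : s.arr 6 v ∈ A <;> simp only [h1, h2, hw] <;>
        simp
  · refine ⟨by simp [Instr.apply], fun v hv => ?_⟩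
    simpa [Instr.apply] using hout v hv
  · rintro s' t ⟨⟨_, h⟩, ht⟩
    refine ⟨h, ?_⟩
    simp only [Nat.sub_zero, add_assoc, Nat.reduceAdd] at ht ⊢
    omega

/-- The computations that do not depend on the targets. -/
def prepare : Prog :=
  labelVertices ;; representatives ;; edgeLists ;; randomThresholds

theorem runs_prepare {n m : ℕ} {s : Store} (h0 : s.reg 0 = n) (h1 : s.reg 1 = m)
    (h3 : s.reg 3 = 0) (h4 : s.reg 4 = 1) (h8 : ∀ c, s.arr 8 c = 0) (h9 : ∀ c, s.arr 9 c = 0) :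
    Runs prepare s fun s' t =>
      (IsRepresentative n (s.arr 37) (s'.arr 6) ∧ ∀ S D : ℕ → ℕ,
        (∀ e, S e = s'.arr 6 (s.arr 1 e)) → (∀ e, D e = s'.arr 6 (s.arr 2 e)) →
          (∀ e < m, s'.arr 13 e = S e) ∧
          (∀ c, s'.arr 8 c = if c < n ∧ s.arr 37 c = 0 ∧ s.arr 0 c = 1 then 1
            else exitCount m S D Set.univ c) ∧
          ∀ c, Linked (s'.arr 10) (s'.arr 9 c) (inList m S D c)) ∧
      t ≤ 17 * n + 15 * m + 8 := by
  refine runs_seq.2 ((runs_labelVertices h0 h4).frame.mono ?_)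
  rintro s₁ t₁ ⟨⟨hlab, ht₁⟩, hf₁⟩
  refine runs_seq.2 ((runs_representatives (n := n) ?_ ?_ ?_).frame.mono ?_)
  · rw [hf₁.reg 0 rfl, h0]
  · rw [hf₁.reg 3 rfl, h3]
  · rw [hf₁.reg 4 rfl, h4]
  rintro s₂ t₂ ⟨⟨hrep, ht₂⟩, hf₂⟩
  rw [hf₁.arr 37 rfl] at hrep
  refine runs_seq.2 ((runs_edgeLists (m := m) (S := fun e => s₂.arr 6 (s₂.arr 1 e))
    (D := fun e => s₂.arr 6 (s₂.arr 2 e)) ?_ ?_ ?_ ?_ (fun _ => rfl) (fun _ => rfl)).frame.mono ?_)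
  · rw [hf₂.reg 1 rfl, hf₁.reg 1 rfl, h1]
  · rw [hf₂.reg 4 rfl, hf₁.reg 4 rfl, h4]
  · rw [hf₂.arr 8 rfl, hf₁.arr 8 rfl]
    exact h8
  · rw [hf₂.arr 9 rfl, hf₁.arr 9 rfl]
    exact h9
  rintro s₃ t₃ ⟨⟨⟨he1, he2, he3⟩, ht₃⟩, hf₃⟩
  refine (runs_randomThresholds (n := n) ?_ ?_ ?_).frame.mono ?_
  · rw [hf₃.reg 0 rfl, hf₂.reg 0 rfl, hf₁.reg 0 rfl, h0]
  · rw [hf₃.reg 3 rfl, hf₂.reg 3 rfl, hf₁.reg 3 rfl, h3]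
  · rw [hf₃.reg 4 rfl, hf₂.reg 4 rfl, hf₁.reg 4 rfl, h4]
  rintro s₄ t₄ ⟨⟨hthr, ht₄⟩, hf₄⟩
  rw [hf₃.arr 37 rfl, hf₂.arr 37 rfl, hf₁.arr 37 rfl, hf₃.arr 0 rfl, hf₂.arr 0 rfl,
    hf₁.arr 0 rfl] at hthr
  have h6 : s₄.arr 6 = s₂.arr 6 := by rw [hf₄.arr 6 rfl, hf₃.arr 6 rfl]
  refine ⟨⟨⟨fun v hv h => ?_, fun v hv => ?_, fun v hv => ?_, fun u hu v hv h huv => ?_⟩,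
    fun S D hS hD => ?_⟩, by omega⟩
  · rw [h6, hrep v hv, if_pos h]
  · rw [h6, hrep v hv]
    split_ifs
    · exact hv
    · exact (hlab v hv).1
  · rw [h6, hrep v hv]
    split_ifs
    · rfl
    · exact (hlab v hv).2
  · rw [h6, hrep u hu, hrep v hv, if_neg h, if_neg (huv ▸ h), huv]
  · have hS' : (fun e => s₂.arr 6 (s₂.arr 1 e)) = S := by
      funext e
      rw [hS, h6, hf₂.arr 1 rfl, hf₁.arr 1 rfl]
    have hD' : (fun e => s₂.arr 6 (s₂.arr 2 e)) = D := by
      funext e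
      rw [hD, h6, hf₂.arr 2 rfl, hf₁.arr 2 rfl]
    rw [hS', hD'] at he3
    rw [hS', hD'] at he2
    refine ⟨fun e he => ?_, fun c => ?_, fun c => ?_⟩
    · rw [hf₄.arr 13 rfl, he1 e he, ← hS']
    · rw [hthr, he2]
    · rw [hf₄.arr 10 rfl, hf₄.arr 9 rfl]
      exact he3 c

end RAM

namespace RAM

/-! ### The input -/

theorem ofList_map {α : Type*} (f : α → ℕ) (l : List α) {i : ℕ} (hi : i < l.length) :
    ofList (l.map f) i = f l[i] := by
  simp [ofList, hi]

theorem ofList_of_length_le {l : List ℕ} {i : ℕ} (hi : l.length ≤ i) : ofList l i = 0 := by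
  simp [ofList, hi]

theorem sum_take_succ_length {α : Type*} (l : List (List α)) {i : ℕ} (hi : i < l.length) :
    ((l.take (i + 1)).map List.length).sum = ((l.take i).map List.length).sum + l[i].length := by
  rw [List.take_succ_eq_append_getElem hi, List.map_append, List.sum_append]
  simp

theorem ofList_flatten {α : Type*} (f : α → ℕ) (l : List (List α)) {i q : ℕ} (hi : i < l.length)
    (hq : q < l[i].length) :
    ofList (l.flatten.map f) (((l.take i).map List.length).sum + q) = f l[i][q] := by
  induction l generalizing i with
  | nil => simp at hi
  | cons a l ih =>
    obtain _ | i := i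
    · simp only [List.getElem_cons_zero] at hq
      simp only [ofList, List.getD_eq_getElem?_getD, List.flatten_cons, List.map_append,
        List.take_zero, List.map_nil, List.sum_nil, zero_add, List.getElem_cons_zero]
      rw [List.getElem?_append_left (by simpa using hq)]
      simp [hq]
    · simp only [List.getElem_cons_succ, List.length_cons, Nat.add_lt_add_iff_right] at hq hi
      have h := ih hi hq
      simp only [ofList, List.getD_eq_getElem?_getD] at h ⊢
      simp only [List.flatten_cons, List.map_append, List.take_succ_cons, List.map_cons,
        List.sum_cons, List.getElem_cons_succ]
      rw [List.getElem?_append_right (by simp; omega)]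
      rw [← h]
      congr 2
      simp
      omega

/-- Choosing one outgoing edge per vertex is injective. This absorbs all terms linear in `n` into
`m`. -/
theorem IsEdgeList.le_length {n : ℕ} {P : MDP (Fin n)} {E : List (Fin n × Fin n)}
    (hE : IsEdgeList P E) : n ≤ E.length := by
  classical
  choose f hf using P.exists_edge
  have h1 : (Finset.univ.image fun v => (v, f v)) ⊆ E.toFinset := by
    intro e he
    obtain ⟨v, -, rfl⟩ := Finset.mem_image.1 he
    exact List.mem_toFinset.2 ((hE.2 _ _).2 (hf v))
  have h2 := (Finset.card_le_card h1).trans (List.toFinset_card_le E)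
  rwa [Finset.card_image_of_injective _ (fun u v h => (Prod.mk.inj h).1), Finset.card_univ,
    Fintype.card_fin] at h2

/-! ### The whole program -/

/-- Copy the graph to where the relocated program for the decomposition expects it. -/
def machineInput : Prog :=
  copyArr 0 0 32 ;; copyArr 1 1 33 ;; copyArr 1 2 34 ;; .instr (.copy 32 0) ;;
    .instr (.copy 33 1)

/-- Copying finitely many cells suffices because the lists of the input and the untouched cells from
offset `32` on are both `0` beyond their ends. -/
theorem runs_machineInput {n k : ℕ} {P : MDP (Fin n)} {E : List (Fin n × Fin n)}
    {L : Fin k → List (Fin n)} {s : Store} (h0 : s.reg 0 = n) (h1 : s.reg 1 = E.length)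
    (h4 : s.reg 4 = 1) (hreg : ∀ r, s.reg (r + 32) = 0) (harr : s.arr = (queryInput P E L).arr) :
    Runs machineInput s fun s' t => Embedded 32 (mdpInput P E) s' ∧
      t ≤ 4 * n + 8 * E.length + 8 := by
  refine runs_seq.2 ((runs_copyArr h4 h0 (by decide) (by decide) (by decide)).frame.mono ?_)
  rintro s₁ t₁ ⟨⟨hc₁, ht₁⟩, hf₁⟩
  refine runs_seq.2 ((runs_copyArr (N := E.length) ?_ ?_ (by decide) (by decide)
    (by decide)).frame.mono ?_)
  · rw [hf₁.reg 4 rfl, h4]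
  · rw [hf₁.reg 1 rfl, h1]
  rintro s₂ t₂ ⟨⟨hc₂, ht₂⟩, hf₂⟩
  refine runs_seq.2 ((runs_copyArr (N := E.length) ?_ ?_ (by decide) (by decide)
    (by decide)).frame.mono ?_)
  · rw [hf₂.reg 4 rfl, hf₁.reg 4 rfl, h4]
  · rw [hf₂.reg 1 rfl, hf₁.reg 1 rfl, h1]
  rintro s₃ t₃ ⟨⟨hc₃, ht₃⟩, hf₃⟩
  simp only [runs_seq, runs_instr, Instr.apply]
  refine ⟨⟨fun r => ?_, fun a => ?_⟩, by omega⟩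
  · have hr : s₃.reg (r + 32) = 0 := by
      rw [hf₃.reg _ (by simp [copyArr, forRange, Prog.writesReg, Instr.writesReg]),
        hf₂.reg _ (by simp [copyArr, forRange, Prog.writesReg, Instr.writesReg]),
        hf₁.reg _ (by simp [copyArr, forRange, Prog.writesReg, Instr.writesReg]), hreg]
    have hr0 : s₃.reg 0 = n := by rw [hf₃.reg 0 rfl, hf₂.reg 0 rfl, hf₁.reg 0 rfl, h0]
    have hr1 : s₃.reg 1 = E.length := by rw [hf₃.reg 1 rfl, hf₂.reg 1 rfl, hf₁.reg 1 rfl, h1]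
    obtain _ | _ | r := r
    · simp [mdpInput, ofList, hr0]
    · simp [mdpInput, ofList, hr1]
    · simp [hr, mdpInput, ofList]
  · obtain _ | _ | _ | a := a
    · funext i
      change s₃.arr 32 i = ofList _ i
      rw [hf₃.arr 32 rfl, hf₂.arr 32 rfl, hc₁ i, harr]
      split_ifs with hi
      · rfl
      · rw [ofList_of_length_le (by simpa using hi)]
        rfl
    · funext i
      change s₃.arr 33 i = ofList _ i
      rw [hf₃.arr 33 rfl, hc₂ i, hf₁.arr 1 rfl, hf₁.arr 33 rfl, harr]
      split_ifs with hi
      · rfl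
      · rw [ofList_of_length_le (by simpa using hi)]
        rfl
    · funext i
      change s₃.arr 34 i = ofList _ i
      rw [hc₃ i, hf₂.arr 2 rfl, hf₁.arr 2 rfl, hf₂.arr 34 rfl, hf₁.arr 34 rfl, harr]
      split_ifs with hi
      · rfl
      · rw [ofList_of_length_le (by simpa using hi)]
        rfl
    · change s₃.arr (a + 35) = fun _ => 0
      rw [hf₃.arr _ (by simp [copyArr, forRange, Prog.writesArr, Instr.writesArr]),
        hf₂.arr _ (by simp [copyArr, forRange, Prog.writesArr, Instr.writesArr]),
        hf₁.arr _ (by simp [copyArr, forRange, Prog.writesArr, Instr.writesArr]), harr]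
      rfl

/-- The program for the disjunctive reachability query that uses the program `M` for the
decomposition into maximal end-components. -/
def disjReach (M : Prog) : Prog :=
  .instr (.const 3 0) ;; .instr (.const 4 1) ;; .instr (.add 5 1 4) ;;
    .ite (.eq 1 3) (.instr .skip) (machineInput ;; M.shift 32 ;; prepare ;; solveQueries)

end RAM

/-- Thresholds matter only below `n`, which is also the range in which those of the program agree
with `loseThreshold`. -/
theorem IsLeastThreshold.congr {n m : ℕ} {S D thr thr' : ℕ → ℕ} {A : Set ℕ}
    (h : IsLeastThreshold n m S D thr A) (heq : ∀ c < n, thr' c = thr c) :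
    IsLeastThreshold n m S D thr' A :=
  ⟨fun c hc => by rw [heq c hc]; exact h.fixed c hc,
    fun B hB => h.least B fun c hc hle => hB c hc (by rw [heq c hc]; exact hle)⟩

/-! ### Correctness and running time of the whole program -/

namespace RAM

/-- What the array accesses of the program see of the input. -/
structure InputSpec {n k : ℕ} (P : MDP (Fin n)) (m : ℕ) (T : Fin k → Set (Fin n))
    (arr : ℕ → ℕ → ℕ) : Prop where
  random : ∀ v : Fin n, arr 0 v = 1 ↔ v ∈ P.random
  edge : ∀ e < m, ∃ u w : Fin n, arr 1 e = u ∧ arr 2 e = w ∧ P.edge u w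
  exists_edge : ∀ u w : Fin n, P.edge u w → ∃ e < m, arr 1 e = u ∧ arr 2 e = w
  le : ∀ i < k, arr 3 i ≤ arr 3 (i + 1)
  length_le : ∀ i < k, arr 3 (i + 1) - arr 3 i ≤ n
  target : ∀ i : Fin k, ∀ x, (∃ j, arr 3 i ≤ j ∧ j < arr 3 (i + 1) ∧ arr 4 j = x) ↔
    ∃ v ∈ T i, (v : ℕ) = x

theorem inputSpec_queryInput {n k : ℕ} {P : MDP (Fin n)} {E : List (Fin n × Fin n)}
    {T : Fin k → Set (Fin n)} {L : Fin k → List (Fin n)} (hE : IsEdgeList P E)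
    (hL : AreTargetLists T L) : InputSpec P E.length T (queryInput P E L).arr := by
  classical
  have h3 : ∀ i ≤ k, (queryInput P E L).arr 3 i =
      (((List.ofFn L).take i).map List.length).sum := by
    intro i hi
    refine (ofList_map _ _ (by simp; omega)).trans ?_
    rw [List.getElem_range]
  have hsucc : ∀ i : Fin k, (queryInput P E L).arr 3 (i + 1) =
      (queryInput P E L).arr 3 i + (L i).length := by
    intro i
    rw [h3 (i + 1) (by omega), h3 i (by omega),
      sum_take_succ_length (i := i) _ (by simp)]
    simp
  have hcell : ∀ i : Fin k, ∀ q, ∀ hq : q < (L i).length,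
      (queryInput P E L).arr 4 ((queryInput P E L).arr 3 i + q) = (L i)[q] := by
    intro i q hq
    rw [h3 _ (by omega)]
    have h4 : (queryInput P E L).arr 4 = ofList ((List.ofFn L).flatten.map Fin.val) := by
      rw [← List.flatMap_pure_eq_map]
      simp only [queryInput, List.map_id']
      rfl
    rw [h4]
    refine (ofList_flatten _ (List.ofFn L) (i := i) (by simp) (by simpa using hq)).trans ?_
    simp
  refine ⟨fun v => ?_, fun e he => ?_, fun u w he => ?_, fun i hi => ?_, fun i hi => ?_,
    fun i x => ⟨?_, ?_⟩⟩
  · have : (queryInput P E L).arr 0 v = if v ∈ P.random then 1 else 0 := by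
      refine (ofList_map _ _ (by simp)).trans ?_
      simp
    rw [this]
    split_ifs with h <;> simp [h]
  · refine ⟨E[e].1, E[e].2, ofList_map _ _ he, ofList_map _ _ he, (hE.2 _ _).1 ?_⟩
    exact List.getElem_mem he
  · obtain ⟨e, hem, heq⟩ := List.getElem_of_mem ((hE.2 u w).2 he)
    refine ⟨e, hem, (ofList_map _ _ hem).trans ?_, (ofList_map _ _ hem).trans ?_⟩ <;> rw [heq]
  · have : (queryInput P E L).arr 3 (i + 1) = (queryInput P E L).arr 3 i + _ := hsucc ⟨i, hi⟩
    omega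
  · have h1 : (queryInput P E L).arr 3 (i + 1) = (queryInput P E L).arr 3 i + _ := hsucc ⟨i, hi⟩
    -- Target lists have no repetitions, so each has at most `n` entries.
    have h2 := (hL ⟨i, hi⟩).1.length_le_card
    rw [Fintype.card_fin] at h2
    omega
  · rintro ⟨j, hj1, hj2, rfl⟩
    rw [hsucc] at hj2
    have h := hcell i (j - (queryInput P E L).arr 3 i) (by omega)
    rw [Nat.add_sub_cancel' hj1] at h
    exact ⟨_, ((hL i).2 _).1 (List.getElem_mem _), h.symm⟩
  · rintro ⟨v, hv, rfl⟩
    obtain ⟨q, hq, heq⟩ := List.getElem_of_mem (((hL i).2 v).2 hv)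
    exact ⟨_, Nat.le_add_right _ q, by rw [hsucc]; omega, by rw [hcell i q hq, heq]⟩

open Classical in
/-- The thresholds that the program uses are those of the losing region. -/
theorem InputSpec.loseThreshold_eq {n k m : ℕ} {P : MDP (Fin n)} {T : Fin k → Set (Fin n)}
    {arr : ℕ → ℕ → ℕ} (h : InputSpec P m T arr) {S D lab rep : ℕ → ℕ} (i : Fin k) {c : ℕ}
    (hc : c < n) : loseThreshold P m S D lab rep (T i) c =
      if ∃ j, arr 3 i ≤ j ∧ j < arr 3 (i + 1) ∧ rep (arr 4 j) = c then m + 1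
      else if c < n ∧ lab c = 0 ∧ arr 0 c = 1 then 1 else exitCount m S D Set.univ c := by
  unfold loseThreshold
  refine if_congr ?_ rfl (if_congr ?_ rfl rfl)
  · constructor
    · rintro ⟨t, ht, rfl⟩
      obtain ⟨j, h1, h2, h3⟩ := (h.target i t).2 ⟨t, ht, rfl⟩
      exact ⟨j, h1, h2, by rw [h3]⟩
    · rintro ⟨j, h1, h2, rfl⟩
      obtain ⟨t, ht, h3⟩ := (h.target i (arr 4 j)).1 ⟨j, h1, h2, rfl⟩
      exact ⟨t, ht, by rw [h3]⟩
  · constructor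
    · rintro ⟨h0, r, hr, rfl⟩
      exact ⟨hc, h0, (h.random r).2 hr⟩
    · rintro ⟨_, h0, h1⟩
      exact ⟨h0, ⟨c, hc⟩, (h.random ⟨c, hc⟩).1 h1, rfl⟩

theorem runs_disjReach {M : Prog} {n k τ : ℕ} {P : MDP (Fin n)} {E : List (Fin n × Fin n)}
    {T : Fin k → Set (Fin n)} {L : Fin k → List (Fin n)} (hk : 1 ≤ k) (hE : IsEdgeList P E)
    (hL : AreTargetLists T L)
    (hM : ∃ (s : Store) (t : ℕ), Exec M (mdpInput P E) s t ∧ t ≤ τ ∧ IsMECOutput P s) :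
    Runs (disjReach M) (queryInput P E L) fun s t =>
      IsSetOutput (P.disjQueryReach T) s ∧ t ≤ 200 * (k * E.length + τ) := by
  classical
  obtain ⟨sM, tM, hexec, htM, hout⟩ := hM
  have htM1 := hexec.one_le
  have hnm := IsEdgeList.le_length hE
  have hspec := inputSpec_queryInput hE hL
  unfold disjReach
  rw [runs_seq, runs_instr, runs_seq, runs_instr, runs_seq, runs_instr, runs_ite]
  set s₀ := (Instr.add 5 1 4).apply ((Instr.const 4 1).apply ((Instr.const 3 0).apply
    (queryInput P E L))) with hs₀
  have h0 : s₀.reg 0 = n := by simp [hs₀, Instr.apply, queryInput, ofList]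
  have h1 : s₀.reg 1 = E.length := by simp [hs₀, Instr.apply, queryInput, ofList]
  have h2 : s₀.reg 2 = k := by simp [hs₀, Instr.apply, queryInput, ofList]
  have h3 : s₀.reg 3 = 0 := by simp [hs₀, Instr.apply]
  have h4 : s₀.reg 4 = 1 := by simp [hs₀, Instr.apply]
  have h5 : s₀.reg 5 = E.length + 1 := by simp [hs₀, Instr.apply, queryInput, ofList]
  have hreg : ∀ r, s₀.reg (r + 32) = 0 := by
    intro r
    simp [hs₀, Instr.apply, queryInput, ofList]
  have harr : s₀.arr = (queryInput P E L).arr := rfl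
  clear_value s₀
  simp only [Test.Holds, h1, h3]
  constructor
  -- Without edges there are no vertices and the output is vacuously correct. This case is separated
  -- because looping over `k` queries would cost time proportional to `k`, while `k * m = 0`; the
  -- few steps taken are paid for by `τ ≥ 1`.
  · intro hm
    rw [runs_instr]
    refine ⟨fun v => ?_, by omega⟩
    have := v.2
    omega
  intro hm
  rw [runs_seq]
  refine (runs_machineInput h0 h1 h4 hreg harr).frame.mono ?_
  rintro s₁ t₁ ⟨⟨hemb, ht₁⟩, hf₁⟩
  obtain ⟨s₂, hexec₂, hemb₂⟩ := hexec.shift 32 hemb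
  have hf₂ := hexec₂.frame
  rw [runs_seq]
  refine ⟨s₂, tM, hexec₂, ?_⟩
  have hreg₂ : ∀ r < 32, machineInput.writesReg r = false → s₂.reg r = s₀.reg r :=
    fun r hr hw => (hf₂.reg r (M.writesReg_shift hr)).trans (hf₁.reg r hw)
  have harr₂ : ∀ a < 32, machineInput.writesArr a = false →
      s₂.arr a = (queryInput P E L).arr a :=
    fun a ha hw => ((hf₂.arr a (M.writesArr_shift ha)).trans (hf₁.arr a hw)).trans (by rw [harr])
  have hlab₂ : s₂.arr 37 = sM.arr 5 := hemb₂.arr 5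
  refine runs_seq.2 ((runs_prepare (n := n) (m := E.length) ?_ ?_ ?_ ?_ ?_ ?_).frame.mono ?_)
  · rw [hreg₂ 0 (by decide) rfl, h0]
  · rw [hreg₂ 1 (by decide) rfl, h1]
  · rw [hreg₂ 3 (by decide) rfl, h3]
  · rw [hreg₂ 4 (by decide) rfl, h4]
  · rw [harr₂ 8 (by decide) rfl]
    exact fun _ => rfl
  · rw [harr₂ 9 (by decide) rfl]
    exact fun _ => rfl
  rintro s₃ t₃ ⟨⟨⟨hrep, hprep⟩, ht₃⟩, hf₃⟩
  rw [hlab₂] at hrep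
  rw [hlab₂, harr₂ 0 (by decide) rfl, harr₂ 1 (by decide) rfl, harr₂ 2 (by decide) rfl] at hprep
  obtain ⟨hS, hbase, hlists⟩ := hprep (fun e => s₃.arr 6 ((queryInput P E L).arr 1 e))
    (fun e => s₃.arr 6 ((queryInput P E L).arr 2 e)) (fun _ => rfl) (fun _ => rfl)
  have hlab : IsMECLabelling P (sM.arr 5) := ⟨hout.1, hout.2⟩
  have harr₃ : ∀ a < 32, machineInput.writesArr a = false → prepare.writesArr a = false →
      s₃.arr a = (queryInput P E L).arr a :=
    fun a ha hw hw' => (hf₃.arr a hw').trans (harr₂ a ha hw)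
  have hreg₃ : ∀ r < 32, machineInput.writesReg r = false → prepare.writesReg r = false →
      s₃.reg r = s₀.reg r :=
    fun r hr hw hw' => (hf₃.reg r hw').trans (hreg₂ r hr hw)
  refine (runs_solveQueries (n := n) (m := E.length) (k := k)
    (S := fun e => s₃.arr 6 ((queryInput P E L).arr 1 e))
    (D := fun e => s₃.arr 6 ((queryInput P E L).arr 2 e))
    (win := fun i v => ∃ (hi : i < k) (hv : v < n),
      (⟨v, hv⟩ : Fin n) ∈ P.almostSure (P.reach (T ⟨i, hi⟩)))
    ?_ ?_ ?_ ?_ ?_ hS ?_ hlists ?_ ?_ ?_ ?_ ?_).mono ?_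
  · rw [hreg₃ 0 (by decide) rfl rfl, h0]
  · rw [hreg₃ 2 (by decide) rfl rfl, h2]
  · rw [hreg₃ 3 (by decide) rfl rfl, h3]
  · rw [hreg₃ 4 (by decide) rfl rfl, h4]
  · rw [hreg₃ 5 (by decide) rfl rfl, h5]
  · intro e he
    obtain ⟨u, w, hu, -, -⟩ := hspec.edge e he
    simp only [hu]
    exact hrep.lt u u.2
  · rw [harr₃ 3 (by decide) rfl rfl]
    exact hspec.le
  · rw [harr₃ 3 (by decide) rfl rfl]
    exact hspec.length_le
  · exact hrep.lt
  · rw [harr₃ 5 (by decide) rfl rfl]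
    exact fun _ _ => rfl
  · intro i hi A hA v hv
    rw [harr₃ 3 (by decide) rfl rfl, harr₃ 4 (by decide) rfl rfl] at hA
    have hA' := hA.congr (thr' := loseThreshold P E.length
      (fun e => s₃.arr 6 ((queryInput P E L).arr 1 e))
      (fun e => s₃.arr 6 ((queryInput P E L).arr 2 e)) (sM.arr 5) (s₃.arr 6) (T ⟨i, hi⟩))
      (fun c hc => by rw [hspec.loseThreshold_eq ⟨i, hi⟩ hc, hbase])
    have hiff := mem_almostSure_iff_threshold hspec.edge hspec.exists_edge (fun _ _ => rfl)
      (fun _ _ => rfl) hlab hrep hA' ⟨v, hv⟩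
    rw [← hiff]
    exact ⟨fun ⟨_, _, h⟩ => h, fun h => ⟨hi, hv, h⟩⟩
  · rintro s₄ t₄ ⟨hres, ht₄⟩
    refine ⟨fun v => ?_, ?_⟩
    · have hiff : v ∈ P.disjQueryReach T ↔ ∃ i < k, ∃ (hi : i < k) (hv : (v : ℕ) < n),
          (⟨v, hv⟩ : Fin n) ∈ P.almostSure (P.reach (T ⟨i, hi⟩)) := by
        constructor
        · rintro ⟨i, hi⟩
          exact ⟨i, i.2, i.2, v.2, hi⟩
        · rintro ⟨i, hi, _, _, h⟩
          exact ⟨⟨i, hi⟩, h⟩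
      rw [hiff, hres v v.2]
      exact ⟨fun h => if_pos h, fun h => if_neg h⟩
    -- With `n ≤ m` and `1 ≤ m`, a query costs at most `37 + 30 + 14 = 81` times `m`. The
    -- preprocessing is linear in `m ≤ k * m`, and the constant `200` leaves room to spare.
    · have h6 : k * (37 * n + 30 * E.length + 14) ≤ k * (81 * E.length) :=
        Nat.mul_le_mul_left k (by omega)
      have h7 : E.length ≤ k * E.length := Nat.le_mul_of_pos_left _ hk
      have h8 : k * (81 * E.length) = 81 * (k * E.length) := by ring
      omega

end RAM

theorem mainTheorem1 :
    ∃ C : ℕ, ∀ (M : RAM.Prog) (MEC : ℕ → ℕ → ℕ), ComputesMEC M MEC →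
      ∃ A : RAM.Prog, ComputesDisjReach A (fun n m k => C * (k * m + MEC n m)) := by
  refine ⟨200, fun M MEC hM => ⟨RAM.disjReach M, fun n k P E T L hk hE hL => ?_⟩⟩
  obtain ⟨s, t, h1, h2, h3⟩ := RAM.runs_disjReach hk hE hL (hM n P E hE)
  exact ⟨s, t, h1, h3, h2⟩
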